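/- Let $n_1,m\ge 0$ be integers (where $m=n_2+\dots+n_k$), let $\Omega_1\subset\mathbb R^{n_1}$ and $\Omega_2\subset\mathbb R^{m}$ be bounded open sets, and put $\Omega=\Omega_1\times\Omega_2\subset\mathbb R^{n_1+m}$, with points written $x=(x_1,x')$. For a smooth vector field $\varphi$ with values in $\mathbb R^{n_1}$ let $\mathrm{div}_{x_1}\varphi=\sum_{i=1}^{n_1}\partial\varphi_i/\partial x_{1,i}$. For $u\in L^1(\Omega)$, write $D_{x_1}u\in\mathcal M(\Omega;\mathbb R^{n_1})$ if there is a finite $\mathbb R^{n_1}$-valued Borel measure $D_{x_1}u$ on $\Omega$ with $$\int_\Omega u\,\mathrm{div}_{x_1}\varphi\,dx=-\int_\Omega\varphi\cdot dD_{x_1}u\qquad\text{for all }\varphi\in C_c^\infty(\Omega;\mathbb R^{n_1}).$$ Let $BV_{x_1}(\Omega)=\{u\in L^1(\Omega): D_{x_1}u\in\mathcal M(\Omega;\mathbb R^{n_1})\}$, and let $\int_\Omega|D_{x_1}u|=|D_{x_1}u|(\Omega)$ be the total variation of this measure (with respect to the Euclidean norm) if $u\in BV_{x_1}(\Omega)$,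 and $\int_\Omega|D_{x_1}u|=+\infty$ if $u\in L^1(\Omega)\setminus BV_{x_1}(\Omega)$. For $u\in L^1(\Omega)$ and $t\in\mathbb R$ let $E_t=\{x\in\Omega: u(x)>t\}$, with characteristic function $\chi_{E_t}$. Let $u\in L^1(\Omega)$. Then $t\mapsto\int_\Omega|D_{x_1}\chi_{E_t}|\in[0,\infty]$ is Lebesgue measurable on $\mathbb R$, and the following hold. (i) If $u\in BV_{x_1}(\Omega)$, then $\chi_{E_t}\in BV_{x_1}(\Omega)$ for almost all $t\in\mathbb R$, and $$\int_\Omega|D_{x_1}u|=\int_{-\infty}^{\infty}\int_\Omega|D_{x_1}\chi_{E_t}|\,dt .$$ (ii) Conversely, if $$\int_{-\infty}^{\infty}\int_\Omega|D_{x_1}\chi_{E_t}|\,dt<\infty,$$ then $u\in BV_{x_1}(\Omega)$. -/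

import Mathlib

open MeasureTheory TopologicalSpace
open scoped ENNReal Distributions

/-- The ambient space `ℝ^{n₁} × ℝ^m`, whose points are written `x = (x₁, x')`.  Its `volume` is the
product Lebesgue measure. -/
abbrev SplitSpace (n₁ m : ℕ) : Type :=
  EuclideanSpace ℝ (Fin n₁) × EuclideanSpace ℝ (Fin m)

/-- The partial divergence `div_{x₁} φ = ∑ᵢ ∂φᵢ/∂x_{1,i}` of a vector field `φ` with values in
`ℝ^{n₁}`: only the derivatives in the directions of the first factor enter. -/
noncomputable def partialDiv {n₁ m : ℕ}
    (φ : SplitSpace n₁ m → EuclideanSpace ℝ (Fin n₁)) (x : SplitSpace n₁ m) : ℝ :=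
  ∑ i : Fin n₁, (fderiv ℝ φ x (EuclideanSpace.single i 1, 0)) i

/-- The finite vector measure `D` on `Ω`, with values in `ℝ^{n₁}`, is the distributional partial
gradient `D_{x₁} u` of `u` on `Ω`:
`∫_Ω u div_{x₁} φ dx = - ∫_Ω φ · dD` for all `φ ∈ C_c^∞(Ω; ℝ^{n₁})`. -/
structure IsPartialGradient {n₁ m : ℕ} (Ω : Opens (SplitSpace n₁ m)) (u : SplitSpace n₁ m → ℝ)
    (D : VectorMeasure Ω (EuclideanSpace ℝ (Fin n₁))) : Prop where
  finite : D.variation Set.univ < ∞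
  integral_eq : ∀ φ : 𝓓(Ω, EuclideanSpace ℝ (Fin n₁)),
    ∫ x in (Ω : Set (SplitSpace n₁ m)), u x * partialDiv φ x
      = - ∫ᵛ x, φ (x : SplitSpace n₁ m) ∂[innerSL ℝ; D]

/-- `u ∈ BV_{x₁}(Ω)`: `u ∈ L¹(Ω)` and `D_{x₁} u` is a finite `ℝ^{n₁}`-valued measure on `Ω`. -/
def MemPartialBV {n₁ m : ℕ} (Ω : Opens (SplitSpace n₁ m)) (u : SplitSpace n₁ m → ℝ) : Prop :=
  IntegrableOn u Ω ∧ ∃ D : VectorMeasure Ω (EuclideanSpace ℝ (Fin n₁)), IsPartialGradient Ω u D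

/-- `∫_Ω |D_{x₁} u| ∈ [0, ∞]`: the total mass of the variation measure `|D_{x₁} u|` if `D_{x₁} u`
is a finite measure, and `∞` otherwise.  (A distribution is represented by at most one finite
measure, so that the infimum runs over a set with at most one element; it is `∞` if the set is
empty.) -/
noncomputable def partialVariation {n₁ m : ℕ} (Ω : Opens (SplitSpace n₁ m))
    (u : SplitSpace n₁ m → ℝ) : ℝ≥0∞ :=
  ⨅ (D : VectorMeasure Ω (EuclideanSpace ℝ (Fin n₁))) (_ : IsPartialGradient Ω u D),
    D.variation Set.univ

/-- The superlevel set `E_t = {x ∈ Ω : u(x) > t}`. -/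
def superlevelSet {n₁ m : ℕ} (Ω : Opens (SplitSpace n₁ m)) (u : SplitSpace n₁ m → ℝ) (t : ℝ) :
    Set (SplitSpace n₁ m) :=
  {x | x ∈ Ω ∧ t < u x}

/-- The characteristic function `χ_{E_t}` of the superlevel set `E_t`. -/
noncomputable def superlevelIndicator {n₁ m : ℕ} (Ω : Opens (SplitSpace n₁ m))
    (u : SplitSpace n₁ m → ℝ) (t : ℝ) : SplitSpace n₁ m → ℝ :=
  (superlevelSet Ω u t).indicator (fun _ => 1)

/-! The proof replaces measures by duality. Let V(u) be `dualVariation`, the supremum of ∫ u div φ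
over test fields with |φ| ≤ 1. A finite V(u) bounds the functional φ ↦ -∫ u div φ, and a Riesz
representation theorem (`exists_vectorMeasure_of_bounded`) yields a gradient measure of total
variation at most V(u). The reverse bound is immediate, so `partialVariation_eq_dualVariation` and
`memPartialBV_iff` reduce everything to V(u) = ∫ V(χ_{E_t}) dt, for arbitrary integrable u and with
values in [0, ∞].

For ≤, u(x) is the integral over t of χ_{E_t}(x) minus a constant depending only on t. Fubini
applies, and the constants vanish because div φ has integral zero
(`dualVariation_le_lintegral_superlevelIndicator`).

For ≥, χ_{E_t} is approximated by a smooth ramp of (u - t)/h. If smooth functions G_j satisfy ∑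
|G_j'| ≤ 1, then ∑ V(G_j ∘ u) ≤ V(u) (`sum_dualVariation_comp_le`): for smooth w, testing each G_j ∘
w against its own φ_j amounts to testing w against the single field ∑ G_j'(w) φ_j, and mollification
passes to general u. With the translates of the ramp by multiples of h, scaled by h, as the G_j,
averaging over the offset bounds the integral of the ramp variations by V(u), with constant 1. Fatou
and lower semicontinuity as h → 0 finish the argument. No density theorem for BV functions is
needed. -/

section

open scoped BoundedContinuousFunction NNReal CompactlySupported

/-! ### Extension of dominated functionals -/

/-- A linear functional on `T` that is dominated by the norm of the image under a linear map into a
normed space factors through a continuous functional of the same bound. -/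
theorem exists_strongDual_comp_eq {T Y : Type*} [AddCommGroup T] [Module ℝ T]
    [NormedAddCommGroup Y] [NormedSpace ℝ Y] (A : T →ₗ[ℝ] Y) (L : T →ₗ[ℝ] ℝ) {C : ℝ} (hC : 0 ≤ C)
    (hL : ∀ φ, L φ ≤ C * ‖A φ‖) :
    ∃ g : StrongDual ℝ Y, (∀ φ, g (A φ) = L φ) ∧ ‖g‖ ≤ C := by
  -- The one-sided bound at `-φ` gives the two-sided one. Hence `L` vanishes on the kernel of `A`
  -- and descends to the range, where Hahn-Banach applies.
  have habs : ∀ φ, ‖L φ‖ ≤ C * ‖A φ‖ := by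
    intro φ
    rw [Real.norm_eq_abs, abs_le]
    have h := hL (-φ)
    rw [map_neg, map_neg, norm_neg] at h
    exact ⟨by linarith, hL φ⟩
  have hker : LinearMap.ker A ≤ LinearMap.ker L := by
    intro φ hφ
    have h := habs φ
    rw [LinearMap.mem_ker.1 hφ, norm_zero, mul_zero] at h
    exact norm_le_zero_iff.1 h
  let f₀ : LinearMap.range A →ₗ[ℝ] ℝ :=
    ((LinearMap.ker A).liftQ L hker).comp A.quotKerEquivRange.symm.toLinearMap
  have hf₀ : ∀ φ, f₀ ⟨A φ, LinearMap.mem_range_self A φ⟩ = L φ := by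
    intro φ
    have h : A.quotKerEquivRange.symm ⟨A φ, LinearMap.mem_range_self A φ⟩
        = (LinearMap.ker A).mkQ φ := A.quotKerEquivRange_symm_apply_image φ _
    simp [f₀, h]
  have hb : ∀ y, ‖f₀ y‖ ≤ C * ‖y‖ := by
    rintro ⟨_, φ, rfl⟩
    rw [hf₀]
    exact habs φ
  obtain ⟨g, hg, hgn⟩ := exists_extension_norm_eq (LinearMap.range A) (f₀.mkContinuous C hb)
  refine ⟨g, fun φ => ?_, hgn.le.trans (LinearMap.mkContinuous_norm_le _ hC _)⟩
  rw [← hf₀ φ, ← LinearMap.mkContinuous_apply f₀ C hb, ← hg]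

/-! ### The total variation functional of a bounded functional -/

section Riesz

variable {X E : Type*} [TopologicalSpace X] [NormedAddCommGroup E] [NormedSpace ℝ E]

/-- The values of a functional on the fields dominated in norm by `f`. -/
def dominatedValues (L : StrongDual ℝ (X →ᵇ E)) (f : X → ℝ≥0) : Set ℝ :=
  {r | ∃ φ : X →ᵇ E, (∀ x, ‖φ x‖ ≤ f x) ∧ L φ = r}

theorem zero_mem_dominatedValues (L : StrongDual ℝ (X →ᵇ E)) (f : X → ℝ≥0) :
    (0 : ℝ) ∈ dominatedValues L f :=
  ⟨0, fun x => by simp, by simp⟩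

theorem dominatedValues_le (L : StrongDual ℝ (X →ᵇ E)) {f : X → ℝ≥0} {M : ℝ≥0}
    (hf : ∀ x, f x ≤ M) {r : ℝ} (hr : r ∈ dominatedValues L f) : r ≤ ‖L‖ * M := by
  obtain ⟨φ, hφ, rfl⟩ := hr
  have h : ‖φ‖ ≤ M := (BoundedContinuousFunction.norm_le M.2).2
    fun x => (hφ x).trans (NNReal.coe_le_coe.2 (hf x))
  exact (le_abs_self _).trans ((L.le_opNorm φ).trans (by gcongr))

theorem exists_bound_compactlySupported (f : C_c(X, ℝ≥0)) : ∃ M : ℝ≥0, ∀ x, f x ≤ M := by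
  obtain ⟨C, hC⟩ := (NNReal.continuous_coe.comp f.continuous).bounded_above_of_compact_support
    (f.hasCompactSupport.comp_left (g := fun r : ℝ≥0 => (r : ℝ)) NNReal.coe_zero)
  refine ⟨C.toNNReal, fun x => ?_⟩
  have h := hC x
  simp only [Function.comp_apply, Real.norm_eq_abs, NNReal.abs_eq] at h
  exact NNReal.le_toNNReal_of_coe_le h

theorem bddAbove_dominatedValues (L : StrongDual ℝ (X →ᵇ E)) (f : C_c(X, ℝ≥0)) :
    BddAbove (dominatedValues L f) := by
  obtain ⟨M, hM⟩ := exists_bound_compactlySupported f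
  exact ⟨_, fun r hr => dominatedValues_le L hM hr⟩

/-- Splitting of a field dominated by `f + g` proportionally to `f` and `g`. -/
theorem exists_split_of_norm_le_add {f g : X → ℝ≥0} (hf : Continuous f) (hg : Continuous g)
    (φ : X →ᵇ E) (hφ : ∀ x, ‖φ x‖ ≤ f x + g x) :
    ∃ φ₁ φ₂ : X →ᵇ E, φ₁ + φ₂ = φ ∧ (∀ x, ‖φ₁ x‖ ≤ f x) ∧ ∀ x, ‖φ₂ x‖ ≤ g x := by
  have hq0 : ∀ x, (0 : ℝ) ≤ f x / (f x + g x) := fun x => by positivity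
  have hq1 : ∀ x, (f x / (f x + g x) : ℝ) ≤ 1 := fun x =>
    div_le_one_of_le₀ (le_add_of_nonneg_right (g x).2) (by positivity)
  have hle : ∀ x, ‖(f x / (f x + g x) : ℝ) • φ x‖ ≤ ‖φ x‖ := fun x => by
    rw [norm_smul, Real.norm_of_nonneg (hq0 x)]
    exact mul_le_of_le_one_left (norm_nonneg _) (hq1 x)
  have hcont : Continuous fun x => (f x / (f x + g x) : ℝ) • φ x := by
    rw [continuous_iff_continuousAt]
    intro x
    -- The quotient may be discontinuous where `f + g` vanishes, but `φ` vanishes there too and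
    -- dominates the product, so squeezing gives continuity.
    by_cases hx : (f x + g x : ℝ) = 0
    · have h0 : φ x = 0 := norm_le_zero_iff.1 (hx ▸ hφ x)
      unfold ContinuousAt
      beta_reduce
      rw [h0, smul_zero, tendsto_zero_iff_norm_tendsto_zero]
      refine squeeze_zero (fun _ => norm_nonneg _) hle ?_
      have := (φ.continuous.norm).tendsto x
      rwa [h0, norm_zero] at this
    · refine ContinuousAt.smul (ContinuousAt.div ?_ ?_ hx) φ.continuous.continuousAt
      · exact (NNReal.continuous_coe.comp hf).continuousAt
      · exact ((NNReal.continuous_coe.comp hf).add (NNReal.continuous_coe.comp hg)).continuousAt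
  let φ₁ : X →ᵇ E := BoundedContinuousFunction.ofNormedAddCommGroup _ hcont ‖φ‖
    fun x => (hle x).trans (φ.norm_coe_le_norm x)
  have hφ₁ : ∀ x, φ₁ x = (f x / (f x + g x) : ℝ) • φ x := fun _ => rfl
  have key : ∀ {a b c : ℝ}, 0 ≤ a → 0 ≤ b → c ≤ a + b → a / (a + b) * c ≤ a := by
    intro a b c ha hb hc
    rcases eq_or_lt_of_le (add_nonneg ha hb) with h | h
    · rw [← h, div_zero, zero_mul]; exact ha
    · rw [div_mul_eq_mul_div, div_le_iff₀ h]
      exact mul_le_mul_of_nonneg_left hc ha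
  refine ⟨φ₁, φ - φ₁, by abel, fun x => ?_, fun x => ?_⟩
  · rw [hφ₁, norm_smul, Real.norm_of_nonneg (hq0 x)]
    exact key (f x).2 (g x).2 (hφ x)
  · rw [BoundedContinuousFunction.sub_apply, hφ₁]
    by_cases hx : (f x + g x : ℝ) = 0
    · have h0 : φ x = 0 := norm_le_zero_iff.1 (hx ▸ hφ x)
      simp [h0]
    · have h1 : φ x - (f x / (f x + g x) : ℝ) • φ x = (g x / (g x + f x) : ℝ) • φ x := by
        nth_rw 1 [← one_smul ℝ (φ x)]
        rw [← sub_smul, add_comm (g x : ℝ)]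
        congr 1
        field_simp
        ring
      rw [h1, norm_smul, Real.norm_of_nonneg (by positivity)]
      exact key (g x).2 (f x).2 ((hφ x).trans_eq (add_comm _ _))

-- One inclusion is the proportional splitting of a field, the other the triangle inequality.
-- Suprema of sums of sets add, which is what makes the total variation functional additive.
open scoped Pointwise in
theorem dominatedValues_add (L : StrongDual ℝ (X →ᵇ E)) (f g : C_c(X, ℝ≥0)) :
    dominatedValues L (f + g : C_c(X, ℝ≥0)) = dominatedValues L f + dominatedValues L g := by
  ext r
  rw [Set.mem_add]
  constructor
  · rintro ⟨φ, hφ, rfl⟩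
    obtain ⟨φ₁, φ₂, h, h₁, h₂⟩ := exists_split_of_norm_le_add f.continuous g.continuous φ
      (by simpa using hφ)
    exact ⟨_, ⟨φ₁, h₁, rfl⟩, _, ⟨φ₂, h₂, rfl⟩, by rw [← map_add, h]⟩
  · rintro ⟨_, ⟨φ₁, h₁, rfl⟩, _, ⟨φ₂, h₂, rfl⟩, rfl⟩
    refine ⟨φ₁ + φ₂, fun x => (norm_add_le _ _).trans ?_, map_add _ _ _⟩
    simpa using add_le_add (h₁ x) (h₂ x)

open scoped Pointwise in
theorem dominatedValues_smul (L : StrongDual ℝ (X →ᵇ E)) (c : ℝ≥0) (f : C_c(X, ℝ≥0)) :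
    dominatedValues L (c • f : C_c(X, ℝ≥0)) = (c : ℝ) • dominatedValues L f := by
  ext r
  rw [Set.mem_smul_set]
  constructor
  · rintro ⟨φ, hφ, rfl⟩
    rcases eq_or_ne c 0 with rfl | hc
    · refine ⟨0, zero_mem_dominatedValues L f, ?_⟩
      have : φ = 0 := by
        ext x
        simpa using hφ x
      simp [this]
    · refine ⟨_, ⟨(c : ℝ)⁻¹ • φ, fun x => ?_, rfl⟩, ?_⟩
      · have h : ‖φ x‖ ≤ c * f x := by simpa using hφ x
        rw [BoundedContinuousFunction.coe_smul, norm_smul, norm_inv, NNReal.norm_eq,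
          inv_mul_le_iff₀ (by positivity)]
        exact h
      · rw [map_smul, smul_smul, mul_inv_cancel₀ (by exact_mod_cast hc), one_smul]
  · rintro ⟨_, ⟨φ, h, rfl⟩, rfl⟩
    refine ⟨(c : ℝ) • φ, fun x => ?_, map_smul _ _ _⟩
    rw [BoundedContinuousFunction.coe_smul, norm_smul, NNReal.norm_eq]
    simpa using mul_le_mul_of_nonneg_left (h x) c.2

/-- The total variation functional `f ↦ sup {L φ : ‖φ‖ ≤ f}` of a bounded functional. -/
noncomputable def totalVariationFunctional (L : StrongDual ℝ (X →ᵇ E)) :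
    C_c(X, ℝ≥0) →ₗ[ℝ≥0] ℝ≥0 where
  toFun f := NNReal.mk (sSup (dominatedValues L f))
    (le_csSup (bddAbove_dominatedValues L f) (zero_mem_dominatedValues L f))
  map_add' f g := by
    apply NNReal.eq
    change sSup (dominatedValues L (f + g : C_c(X, ℝ≥0))) = _
    rw [dominatedValues_add, csSup_add ⟨0, zero_mem_dominatedValues L f⟩
      (bddAbove_dominatedValues L f) ⟨0, zero_mem_dominatedValues L g⟩
      (bddAbove_dominatedValues L g)]
    rfl
  map_smul' c f := by
    apply NNReal.eq
    have h : sSup (dominatedValues L (c • f : C_c(X, ℝ≥0)))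
        = (c : ℝ) * sSup (dominatedValues L f) := by
      rw [dominatedValues_smul]
      exact Real.sSup_smul_of_nonneg c.2 _
    exact h

theorem le_totalVariationFunctional (L : StrongDual ℝ (X →ᵇ E)) {f : C_c(X, ℝ≥0)} {φ : X →ᵇ E}
    (h : ∀ x, ‖φ x‖ ≤ f x) : L φ ≤ totalVariationFunctional L f :=
  le_csSup (bddAbove_dominatedValues L f) ⟨φ, h, rfl⟩

theorem totalVariationFunctional_le (L : StrongDual ℝ (X →ᵇ E)) {f : C_c(X, ℝ≥0)}
    (h : ∀ x, f x ≤ 1) : (totalVariationFunctional L f : ℝ) ≤ ‖L‖ := by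
  refine csSup_le ⟨0, zero_mem_dominatedValues L f⟩ fun r hr => ?_
  simpa using dominatedValues_le L h hr

end Riesz

end

/-! ### Vector measures with density and Riesz representation -/

section

open scoped BoundedContinuousFunction NNReal CompactlySupported

section WithDensity

variable {X E F G : Type*} {mX : MeasurableSpace X} {μ : Measure X}
  [NormedAddCommGroup E] [NormedSpace ℝ E] [NormedAddCommGroup F] [NormedSpace ℝ F]
  [NormedAddCommGroup G] [NormedSpace ℝ G] {σ : X → F} {f g : X → E}

/-- This estimate gives both the integrability of the pairing and the L¹-continuity of its integral
in `f`. -/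
theorem lintegral_enorm_bilin_le (B : E →L[ℝ] F →L[ℝ] G) (hσ : Integrable σ μ)
    (hf : AEStronglyMeasurable f (μ.withDensity fun x => ‖σ x‖ₑ)) :
    ∫⁻ x, ‖B (f x) (σ x)‖ₑ ∂μ ≤ ‖B‖ₑ * ∫⁻ x, ‖f x‖ₑ ∂(μ.withDensity fun x => ‖σ x‖ₑ) := by
  rw [lintegral_withDensity_eq_lintegral_mul₀' hσ.1.enorm hf.enorm,
    ← lintegral_const_mul' _ _ enorm_ne_top]
  refine lintegral_mono fun x => ?_
  refine ((B (f x)).le_opENorm (σ x)).trans ?_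
  rw [Pi.mul_apply, mul_comm ‖σ x‖ₑ, ← mul_assoc]
  gcongr
  exact B.le_opENorm (f x)

theorem integrable_bilin_of_integrable_withDensity (B : E →L[ℝ] F →L[ℝ] G) (hσ : Integrable σ μ)
    (hf : Integrable f (μ.withDensity fun x => ‖σ x‖ₑ)) :
    Integrable (fun x => B (f x) (σ x)) μ := by
  refine ⟨?_, (lintegral_enorm_bilin_le B hσ hf.1).trans_lt
    (ENNReal.mul_lt_top enorm_lt_top hf.2)⟩
  -- Measurability of `f` for the weighted measure says nothing where `σ` vanishes. The pairing is
  -- therefore written as that of `‖σ‖ f` with `‖σ‖⁻¹ σ`, which are both measurable for `μ`.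
  have h1 : AEStronglyMeasurable (fun x => ‖σ x‖₊ • f x) μ := by
    obtain ⟨τ, hτ, hστ⟩ := hσ.1
    have hf' : AEStronglyMeasurable f (μ.withDensity fun x => (‖τ x‖₊ : ℝ≥0∞)) := by
      rw [← withDensity_congr_ae (f := fun x => ‖σ x‖ₑ)]
      · exact hf.1
      · filter_upwards [hστ] with x hx
        rw [hx, enorm_eq_nnnorm]
    rw [aestronglyMeasurable_withDensity_iff hτ.nnnorm.measurable] at hf'
    refine hf'.congr ?_
    filter_upwards [hστ] with x hx
    rw [hx, NNReal.smul_def, coe_nnnorm]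
  have h2 : AEStronglyMeasurable (fun x => ‖σ x‖⁻¹ • σ x) μ := by
    have := hσ.1.norm.aemeasurable.inv.aestronglyMeasurable
    exact this.smul hσ.1
  refine (B.aestronglyMeasurable_comp₂ h1 h2).congr (Filter.Eventually.of_forall fun x => ?_)
  rcases eq_or_ne (σ x) 0 with h | h
  · simp [h]
  · simp only [NNReal.smul_def, coe_nnnorm, map_smul, smul_apply]
    rw [smul_smul, inv_mul_cancel₀ (norm_ne_zero_iff.2 h), one_smul]

theorem ae_bilin_eq_of_ae_withDensity (B : E →L[ℝ] F →L[ℝ] G) (hσ : Integrable σ μ)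
    (h : f =ᵐ[μ.withDensity fun x => ‖σ x‖ₑ] g) :
    (fun x => B (f x) (σ x)) =ᵐ[μ] fun x => B (g x) (σ x) := by
  filter_upwards [(ae_withDensity_iff' hσ.1.enorm).1 h] with x hx
  rcases eq_or_ne (σ x) 0 with h | h
  · simp [h]
  · rw [hx (by simpa using h)]

/-- Integration against a vector measure with density is integration of the pairing with the
density. -/
theorem vectorIntegral_withDensityᵥ [CompleteSpace F] [CompleteSpace G] (B : E →L[ℝ] F →L[ℝ] G)
    (hσ : Integrable σ μ) (hf : Integrable f (μ.withDensity fun x => ‖σ x‖ₑ)) :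
    VectorMeasure.integral (μ.withDensityᵥ σ) f B = ∫ x, B (f x) (σ x) ∂μ := by
  have hvar := Measure.variation_withDensityᵥ hσ
  rw [← hvar] at hf
  refine Integrable.induction (fun f : X → E =>
    VectorMeasure.integral (μ.withDensityᵥ σ) f B = ∫ x, B (f x) (σ x) ∂μ) ?_ ?_ ?_ ?_ hf
  · intro c s hs hlt
    rw [VectorMeasure.integral_indicator hs]
    have hfin : IsFiniteMeasure ((μ.withDensityᵥ σ).variation.restrict s) :=
      ⟨by rwa [Measure.restrict_apply_univ]⟩
    rw [VectorMeasure.setIntegral_const, withDensityᵥ_apply hσ hs]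
    have h : ∀ x, B (s.indicator (fun _ => c) x) (σ x) = s.indicator (fun x => B c (σ x)) x := by
      intro x
      by_cases hx : x ∈ s <;> simp [hx]
    simp_rw [h]
    rw [integral_indicator hs, (B c).integral_comp_comm hσ.integrableOn]
  · intro f g _ hf hg hf' hg'
    rw [VectorMeasure.integral_add hf hg, hf', hg', ← integral_add]
    · simp
    · exact integrable_bilin_of_integrable_withDensity B hσ (hvar ▸ hf)
    · exact integrable_bilin_of_integrable_withDensity B hσ (hvar ▸ hg)
  -- The right-hand side is Lipschitz in `f` for the L¹ norm of the variation, with constant `‖B‖`.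
  · refine isClosed_eq VectorMeasure.continuous_integral ?_
    have hint : ∀ f : X →₁[(μ.withDensityᵥ σ).variation] E,
        Integrable (fun x => B (f x) (σ x)) μ := fun f =>
      integrable_bilin_of_integrable_withDensity B hσ (hvar ▸ L1.integrable_coeFn f)
    refine LipschitzWith.continuous (K := ‖B‖₊) fun f g => ?_
    rw [edist_eq_enorm_sub, ← integral_sub (hint f) (hint g), edist_eq_enorm_sub,
      Lp.enorm_def, eLpNorm_one_eq_lintegral_enorm]
    refine (enorm_integral_le_lintegral_enorm _).trans ?_
    have h := lintegral_enorm_bilin_le B hσ (f := fun x => f x - g x)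
      (hvar ▸ ((L1.integrable_coeFn f).sub (L1.integrable_coeFn g)).1)
    simp only [map_sub, sub_apply] at h
    refine h.trans_eq ?_
    rw [← hvar]
    congr 1
    refine lintegral_congr_ae ?_
    filter_upwards [Lp.coeFn_sub f g] with x hx
    rw [hx, Pi.sub_apply]
  · intro f g hfg hf hf'
    rw [← VectorMeasure.integral_congr_ae hfg, hf']
    exact integral_congr_ae (ae_bilin_eq_of_ae_withDensity B hσ (hvar ▸ hfg))

end WithDensity

section Riesz

variable {X E : Type*} [TopologicalSpace X] [T2Space X] [LocallyCompactSpace X]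
  [MeasurableSpace X] [BorelSpace X]

/-- Inner regularity reduces the total mass to compact sets, and a Urysohn function with values in
[0, 1] bounds the mass of each by `‖L‖`. -/
theorem rieszMeasure_totalVariationFunctional_univ_le [NormedAddCommGroup E] [NormedSpace ℝ E]
    (L : StrongDual ℝ (X →ᵇ E)) :
    NNRealRMK.rieszMeasure (totalVariationFunctional L) Set.univ ≤ ‖L‖ₑ := by
  rw [isOpen_univ.measure_eq_iSup_isCompact]
  refine iSup_le fun K => iSup_le fun _ => iSup_le fun hK => ?_
  obtain ⟨f, hf1, -, hfc, hf⟩ := exists_continuous_one_zero_of_isCompact hK isClosed_empty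
    (Set.disjoint_empty K)
  let g : C_c(X, ℝ≥0) := ⟨⟨fun x => (f x).toNNReal, by fun_prop⟩,
    hfc.comp_left (g := Real.toNNReal) Real.toNNReal_zero⟩
  have hg : ∀ x, g x = (f x).toNNReal := fun _ => rfl
  calc NNRealRMK.rieszMeasure (totalVariationFunctional L) K
      = ∫⁻ x in K, 1 ∂NNRealRMK.rieszMeasure (totalVariationFunctional L) := by simp
    _ ≤ ∫⁻ x in K, g x ∂NNRealRMK.rieszMeasure (totalVariationFunctional L) := by
        refine setLIntegral_mono' hK.measurableSet fun x hx => ?_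
        simp [hg, hf1 hx]
    _ ≤ ∫⁻ x, g x ∂NNRealRMK.rieszMeasure (totalVariationFunctional L) :=
        setLIntegral_le_lintegral _ _
    _ = totalVariationFunctional L g := NNRealRMK.lintegral_rieszMeasure _ g
    _ ≤ ‖L‖ₑ := by
        rw [enorm_eq_nnnorm, ENNReal.coe_le_coe]
        exact totalVariationFunctional_le L fun x => by
          rw [hg]; exact Real.toNNReal_le_one.2 (hf x).2

variable [NormedAddCommGroup E] [InnerProductSpace ℝ E] [FiniteDimensional ℝ E]

/-- **Riesz representation** of a bounded functional on compactly supported vector fields by a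
vector measure, with the sharp bound of its total variation. -/
theorem exists_vectorMeasure_of_bounded {T : Type*} [AddCommGroup T] [Module ℝ T]
    (ι : T →ₗ[ℝ] (X →ᵇ E)) (hι : ∀ φ, HasCompactSupport (ι φ)) (L : T →ₗ[ℝ] ℝ) (C : ℝ≥0)
    (hL : ∀ φ, L φ ≤ C * ‖ι φ‖) :
    ∃ D : VectorMeasure X E, D.variation Set.univ ≤ C ∧
      ∀ φ, VectorMeasure.integral D (ι φ) (innerSL ℝ) = L φ := by
  borelize E
  obtain ⟨L', hL', hL'C⟩ := exists_strongDual_comp_eq ι L C.2 hL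
  set μ := NNRealRMK.rieszMeasure (totalVariationFunctional L') with hμ
  have hμC : μ Set.univ ≤ C := by
    refine (rieszMeasure_totalVariationFunctional_univ_le L').trans ?_
    rw [enorm_eq_nnnorm, ENNReal.coe_le_coe]
    exact hL'C
  have hfin : IsFiniteMeasure μ := ⟨hμC.trans_lt ENNReal.coe_lt_top⟩
  -- By Cauchy-Schwarz, L φ ≤ ∫ ‖φ‖ dμ ≤ m ‖φ‖₂, so `L` extends to L²(μ) and is represented by some
  -- `σ` with ‖σ‖₂ ≤ m. A second use gives ∫ ‖σ‖ dμ ≤ m ‖σ‖₂ ≤ m² = μ(X) ≤ C: the sharp bound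
  -- follows without showing ‖σ‖ ≤ 1 almost everywhere.
  set m : ℝ≥0∞ := μ Set.univ ^ (1 / 2 : ℝ) with hm
  have hm_top : m ≠ ∞ := ENNReal.rpow_ne_top_of_nonneg (by norm_num) (measure_ne_top _ _)
  have hmm : m * m = μ Set.univ := by
    rw [hm, ← ENNReal.rpow_add_of_nonneg _ _ (by norm_num) (by norm_num)]
    norm_num
  have hCS : ∀ f : X → E, AEStronglyMeasurable f μ → eLpNorm f 1 μ ≤ eLpNorm f 2 μ * m := by
    intro f hf
    have h := eLpNorm_le_eLpNorm_mul_rpow_measure_univ (μ := μ) (p := 1) (q := 2)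
      (by norm_num) hf
    convert h using 2
    rw [hm]
    norm_num
  let A : T →ₗ[ℝ] Lp E 2 μ :=
    (BoundedContinuousFunction.toLp (E := E) 2 μ ℝ).toLinearMap.comp ι
  have hA : ∀ φ, A φ =ᵐ[μ] ι φ := fun φ => BoundedContinuousFunction.coeFn_toLp 2 μ ℝ (ι φ)
  have hbound : ∀ φ, L φ ≤ m.toReal * ‖A φ‖ := by
    intro φ
    let f : C_c(X, ℝ≥0) := ⟨⟨fun x => ‖ι φ x‖₊, by fun_prop⟩,
      (hι φ).comp_left (g := fun y : E => ‖y‖₊) nnnorm_zero⟩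
    have h1 : L φ ≤ totalVariationFunctional L' f := by
      rw [← hL' φ]
      exact le_totalVariationFunctional L' fun x => le_rfl
    have h2 : (totalVariationFunctional L' f : ℝ≥0∞) = eLpNorm (A φ) 1 μ := by
      rw [← NNRealRMK.lintegral_rieszMeasure, eLpNorm_congr_ae (hA φ),
        eLpNorm_one_eq_lintegral_enorm]
      rfl
    have h3 := hCS (A φ) (Lp.aestronglyMeasurable _)
    rw [← h2, ← Lp.enorm_def] at h3
    have h4 := ENNReal.toReal_mono (ENNReal.mul_ne_top enorm_ne_top hm_top) h3
    rw [ENNReal.coe_toReal, ENNReal.toReal_mul, toReal_enorm] at h4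
    linarith
  obtain ⟨g, hg, hgm⟩ := exists_strongDual_comp_eq A L ENNReal.toReal_nonneg hbound
  set σ := (InnerProductSpace.toDual ℝ (Lp E 2 μ)).symm g with hσ_def
  have hσm : ‖σ‖ₑ ≤ m := by
    rw [← ENNReal.toReal_le_toReal enorm_ne_top hm_top, toReal_enorm, hσ_def,
      LinearIsometryEquiv.norm_map]
    exact hgm
  have hσ : Integrable σ μ := (Lp.memLp σ).integrable (by norm_num)
  have hvar := Measure.variation_withDensityᵥ hσ
  have hvar_le : (μ.withDensityᵥ σ).variation Set.univ ≤ μ Set.univ := by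
    rw [hvar, withDensity_apply _ MeasurableSet.univ, Measure.restrict_univ,
      ← eLpNorm_one_eq_lintegral_enorm, ← hmm]
    refine (hCS σ (Lp.aestronglyMeasurable _)).trans ?_
    rw [← Lp.enorm_def]
    gcongr
  refine ⟨μ.withDensityᵥ σ, hvar_le.trans hμC, fun φ => ?_⟩
  have hfin' : IsFiniteMeasure (μ.withDensity fun x => ‖σ x‖ₑ) :=
    ⟨by rw [← hvar]; exact hvar_le.trans_lt (measure_lt_top _ _)⟩
  rw [vectorIntegral_withDensityᵥ _ hσ ((ι φ).integrable _), ← hg φ,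
    ← InnerProductSpace.toDual_symm_apply, L2.inner_def]
  refine integral_congr_ae ?_
  filter_upwards [hA φ] with x hx
  rw [innerSL_apply_apply, hx, real_inner_comm]

end Riesz

end

/-! ### Partial divergence, and variation by duality -/

section

open scoped BoundedContinuousFunction NNReal CompactlySupported

section PartialDiv

variable {n₁ m : ℕ} {φ ψ : SplitSpace n₁ m → EuclideanSpace ℝ (Fin n₁)} {x : SplitSpace n₁ m}

instance isAddHaarMeasure_volume_splitSpace (n₁ m : ℕ) :
    Measure.IsAddHaarMeasure (volume : Measure (SplitSpace n₁ m)) :=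
  inferInstanceAs (Measure.IsAddHaarMeasure (Measure.prod volume volume))

theorem partialDiv_add (hφ : DifferentiableAt ℝ φ x) (hψ : DifferentiableAt ℝ ψ x) :
    partialDiv (φ + ψ) x = partialDiv φ x + partialDiv ψ x := by
  simp [partialDiv, fderiv_add hφ hψ, Finset.sum_add_distrib]

theorem partialDiv_const_smul (hφ : DifferentiableAt ℝ φ x) (c : ℝ) :
    partialDiv (c • φ) x = c * partialDiv φ x := by
  simp [partialDiv, fderiv_const_smul hφ, Finset.mul_sum]

theorem partialDiv_eq_zero_of_notMem_tsupport (hx : x ∉ tsupport φ) : partialDiv φ x = 0 := by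
  simp [partialDiv, fderiv_of_notMem_tsupport ℝ hx]

theorem continuous_partialDiv (hφ : ContDiff ℝ 1 φ) : Continuous (partialDiv φ) := by
  have h := hφ.continuous_fderiv one_ne_zero
  refine continuous_finsetSum _ fun i _ => ?_
  have h' : Continuous fun x => fderiv ℝ φ x (EuclideanSpace.single i 1, 0) := h.clm_apply continuous_const
  exact (EuclideanSpace.proj (𝕜 := ℝ) i).continuous.comp h'

theorem hasCompactSupport_partialDiv (hφ : HasCompactSupport φ) :
    HasCompactSupport (partialDiv φ) :=
  HasCompactSupport.intro hφ fun _ hx => partialDiv_eq_zero_of_notMem_tsupport hx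

variable {Ω : Opens (SplitSpace n₁ m)}

theorem TestFunction.differentiable (φ : 𝓓(Ω, EuclideanSpace ℝ (Fin n₁))) :
    Differentiable ℝ φ :=
  φ.contDiff.differentiable (by simp)

theorem TestFunction.contDiff_one (φ : 𝓓(Ω, EuclideanSpace ℝ (Fin n₁))) :
    ContDiff ℝ 1 φ :=
  φ.contDiff.of_le (by exact_mod_cast le_top)

theorem TestFunction.continuous_partialDiv (φ : 𝓓(Ω, EuclideanSpace ℝ (Fin n₁))) :
    Continuous (partialDiv φ) :=
  _root_.continuous_partialDiv φ.contDiff_one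

theorem TestFunction.exists_bound_partialDiv (φ : 𝓓(Ω, EuclideanSpace ℝ (Fin n₁))) :
    ∃ C, ∀ x, ‖partialDiv φ x‖ ≤ C :=
  φ.continuous_partialDiv.bounded_above_of_compact_support
    (hasCompactSupport_partialDiv φ.hasCompactSupport)

theorem TestFunction.integrable_partialDiv (φ : 𝓓(Ω, EuclideanSpace ℝ (Fin n₁))) :
    Integrable (partialDiv φ) :=
  φ.continuous_partialDiv.integrable_of_hasCompactSupport
    (hasCompactSupport_partialDiv φ.hasCompactSupport)

theorem integrable_mul_partialDiv {μ : Measure (SplitSpace n₁ m)} {u : SplitSpace n₁ m → ℝ}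
    (hu : Integrable u μ)
    (φ : 𝓓(Ω, EuclideanSpace ℝ (Fin n₁))) : Integrable (fun x => u x * partialDiv φ x) μ := by
  obtain ⟨C, hC⟩ := φ.exists_bound_partialDiv
  exact hu.mul_bdd φ.continuous_partialDiv.aestronglyMeasurable (Filter.Eventually.of_forall hC)

/-- Test fields are supported in `Ω`, so values of `u` outside are irrelevant. This gives access to
translation and integration by parts on the whole space. -/
theorem setIntegral_mul_partialDiv (u : SplitSpace n₁ m → ℝ)
    (φ : 𝓓(Ω, EuclideanSpace ℝ (Fin n₁))) :
    ∫ x in (Ω : Set (SplitSpace n₁ m)), u x * partialDiv φ x = ∫ x, u x * partialDiv φ x := by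
  refine setIntegral_eq_integral_of_forall_compl_eq_zero fun x hx => ?_
  rw [partialDiv_eq_zero_of_notMem_tsupport fun h => hx (φ.tsupport_subset h), mul_zero]

end PartialDiv

section Variation

variable {n₁ m : ℕ} {Ω : Opens (SplitSpace n₁ m)} {u v : SplitSpace n₁ m → ℝ}

/-- The total variation of `u` in the directions of the first factor, defined by duality with test
fields of norm at most one. -/
noncomputable def dualVariation (Ω : Opens (SplitSpace n₁ m)) (u : SplitSpace n₁ m → ℝ) : ℝ≥0∞ :=
  ⨆ (φ : 𝓓(Ω, EuclideanSpace ℝ (Fin n₁))) (_ : ∀ x, ‖φ x‖ ≤ 1),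
    ENNReal.ofReal (∫ x in (Ω : Set (SplitSpace n₁ m)), u x * partialDiv φ x)

theorem le_dualVariation (u : SplitSpace n₁ m → ℝ) (φ : 𝓓(Ω, EuclideanSpace ℝ (Fin n₁)))
    (hφ : ∀ x, ‖φ x‖ ≤ 1) :
    ENNReal.ofReal (∫ x in (Ω : Set (SplitSpace n₁ m)), u x * partialDiv φ x)
      ≤ dualVariation Ω u :=
  le_iSup₂_of_le φ hφ le_rfl

theorem dualVariation_le_variation {D : VectorMeasure Ω (EuclideanSpace ℝ (Fin n₁))}
    (hD : IsPartialGradient Ω u D) : dualVariation Ω u ≤ D.variation Set.univ := by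
  refine iSup₂_le fun φ hφ => ?_
  rw [hD.integral_eq φ]
  have h1 : ‖innerSL ℝ (E := EuclideanSpace ℝ (Fin n₁))‖ₑ ≤ 1 := by
    rw [← ENNReal.ofReal_one, ← ofReal_norm]
    exact ENNReal.ofReal_le_ofReal (norm_innerSL_le ℝ)
  refine (ENNReal.ofReal_le_ofReal ((le_abs_self _).trans_eq (abs_neg _))).trans ?_
  rw [← Real.norm_eq_abs, ofReal_norm]
  refine (VectorMeasure.enorm_integral_le_of_enorm_le_const (C := 1)
    (Filter.Eventually.of_forall fun x => ?_)).trans ?_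
  · rw [← ofReal_norm, ← ENNReal.ofReal_one]
    exact ENNReal.ofReal_le_ofReal (hφ x)
  · rw [one_mul]
    exact mul_le_of_le_one_left' h1

/-- Restriction of test fields to `Ω`, as bounded continuous functions. -/
noncomputable def restrictTestFunction (Ω : Opens (SplitSpace n₁ m)) :
    𝓓(Ω, EuclideanSpace ℝ (Fin n₁)) →ₗ[ℝ] (Ω →ᵇ EuclideanSpace ℝ (Fin n₁)) where
  toFun φ := (φ : SplitSpace n₁ m →ᵇ EuclideanSpace ℝ (Fin n₁)).compContinuous
    ⟨Subtype.val, continuous_subtype_val⟩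
  map_add' _ _ := rfl
  map_smul' _ _ := rfl

theorem hasCompactSupport_restrictTestFunction (φ : 𝓓(Ω, EuclideanSpace ℝ (Fin n₁))) :
    HasCompactSupport (restrictTestFunction Ω φ) := by
  have hK : IsCompact ((Subtype.val : Ω → SplitSpace n₁ m) ⁻¹' tsupport φ) :=
    (Topology.IsEmbedding.subtypeVal.isInducing.isCompact_preimage_iff (by
      rw [Subtype.range_coe]; exact φ.tsupport_subset)).2 φ.hasCompactSupport
  refine HasCompactSupport.intro hK fun x hx => ?_
  exact image_eq_zero_of_notMem_tsupport (f := φ) hx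

theorem norm_le_norm_restrictTestFunction (φ : 𝓓(Ω, EuclideanSpace ℝ (Fin n₁)))
    (x : SplitSpace n₁ m) : ‖φ x‖ ≤ ‖restrictTestFunction Ω φ‖ := by
  by_cases hx : x ∈ Ω
  · exact (restrictTestFunction Ω φ).norm_coe_le_norm ⟨x, hx⟩
  · rw [image_eq_zero_of_notMem_tsupport fun h => hx (φ.tsupport_subset h), norm_zero]
    exact norm_nonneg _

/-- The functional `φ ↦ -∫ u div φ` on test fields. -/
noncomputable def partialGradientFunctional (hu : IntegrableOn u Ω) :
    𝓓(Ω, EuclideanSpace ℝ (Fin n₁)) →ₗ[ℝ] ℝ where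
  toFun φ := -∫ x in (Ω : Set (SplitSpace n₁ m)), u x * partialDiv φ x
  map_add' φ ψ := by
    rw [← neg_add, ← integral_add (integrable_mul_partialDiv hu φ)
      (integrable_mul_partialDiv hu ψ)]
    congr 2
    ext x
    rw [FunLike.coe_add, partialDiv_add (φ.differentiable x) (ψ.differentiable x), mul_add]
  map_smul' c φ := by
    rw [RingHom.id_apply, smul_eq_mul, mul_neg, ← integral_const_mul]
    congr 2
    ext x
    rw [FunLike.coe_smul, partialDiv_const_smul (φ.differentiable x)]
    ring

theorem exists_isPartialGradient (hu : IntegrableOn u Ω) (h : dualVariation Ω u ≠ ∞) :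
    ∃ D, IsPartialGradient Ω u D ∧ D.variation Set.univ ≤ dualVariation Ω u := by
  have hL : ∀ φ, partialGradientFunctional hu φ
      ≤ (dualVariation Ω u).toNNReal * ‖restrictTestFunction Ω φ‖ := by
    intro φ
    set r := ‖restrictTestFunction Ω φ‖ with hr
    rcases eq_or_lt_of_le (norm_nonneg (restrictTestFunction Ω φ)) with h0 | h0
    · have hφ : φ = 0 := by
        ext1 x
        have := norm_le_norm_restrictTestFunction φ x
        rw [← h0] at this
        simpa using this
      rw [hφ, map_zero]
      positivity
    -- Normalization makes the field admissible; the sign cancels the minus in the functional.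
    · have h1 := le_dualVariation u (-(r⁻¹) • φ) fun x => by
        rw [FunLike.coe_smul, Pi.smul_apply, norm_smul, norm_neg, norm_inv, hr, norm_norm,
          inv_mul_le_iff₀ h0, mul_one]
        exact norm_le_norm_restrictTestFunction φ x
      have h2 : ∫ x in (Ω : Set (SplitSpace n₁ m)), u x * partialDiv (-(r⁻¹) • φ) x
          = r⁻¹ * partialGradientFunctional hu φ := by
        have := (partialGradientFunctional hu).map_smul (-(r⁻¹)) φ
        change -_ = _ at this
        rw [neg_eq_iff_eq_neg] at this
        rw [this, smul_eq_mul]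
        ring
      rw [h2, ← ENNReal.coe_toNNReal h, ENNReal.ofReal, ENNReal.coe_le_coe,
        Real.toNNReal_le_iff_le_coe, inv_mul_le_iff₀ h0] at h1
      linarith
  have : LocallyCompactSpace Ω := Ω.isOpen.locallyCompactSpace
  obtain ⟨D, hD, hDi⟩ := exists_vectorMeasure_of_bounded (restrictTestFunction Ω)
    hasCompactSupport_restrictTestFunction (partialGradientFunctional hu) _ hL
  rw [ENNReal.coe_toNNReal h] at hD
  refine ⟨D, ⟨hD.trans_lt h.lt_top, fun φ => ?_⟩, hD⟩
  have h1 := hDi φ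
  change VectorMeasure.integral D (fun x : Ω => φ x) (innerSL ℝ) = -_ at h1
  rw [h1, neg_neg]

theorem partialVariation_eq_dualVariation (hu : IntegrableOn u Ω) :
    partialVariation Ω u = dualVariation Ω u := by
  refine le_antisymm ?_ (le_iInf₂ fun D hD => dualVariation_le_variation hD)
  rcases eq_or_ne (dualVariation Ω u) ∞ with h | h
  · rw [h]; exact le_top
  · obtain ⟨D, hD, hDle⟩ := exists_isPartialGradient hu h
    exact (iInf₂_le D hD).trans hDle

theorem memPartialBV_iff (hu : IntegrableOn u Ω) :
    MemPartialBV Ω u ↔ dualVariation Ω u < ∞ := by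
  constructor
  · rintro ⟨-, D, hD⟩
    exact (dualVariation_le_variation hD).trans_lt hD.finite
  · intro h
    obtain ⟨D, hD, -⟩ := exists_isPartialGradient hu h.ne
    exact ⟨hu, D, hD⟩

end Variation

end

/-! ### Semicontinuity, measurability in the level, and the chain rule -/

section

open Filter Topology
open scoped NNReal ContDiff

section Semicontinuity

variable {n₁ m : ℕ} {Ω : Opens (SplitSpace n₁ m)} {u v : SplitSpace n₁ m → ℝ}

theorem dualVariation_const_mul {c : ℝ} (hc : 0 ≤ c) (u : SplitSpace n₁ m → ℝ) :
    dualVariation Ω (fun x => c * u x) = ENNReal.ofReal c * dualVariation Ω u := by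
  unfold dualVariation
  simp_rw [ENNReal.mul_iSup, ← ENNReal.ofReal_mul hc, mul_assoc, integral_const_mul]

theorem tendsto_integral_mul_partialDiv {ι : Type*} {l : Filter ι} [l.IsCountablyGenerated]
    {w : ι → SplitSpace n₁ m → ℝ} {w₀ : SplitSpace n₁ m → ℝ} {μ : Measure (SplitSpace n₁ m)}
    (hμ : μ ≤ volume) {C : ℝ}
    (hmeas : ∀ᶠ i in l, AEStronglyMeasurable (w i) μ) (hb : ∀ᶠ i in l, ∀ x, ‖w i x‖ ≤ C)
    (hlim : ∀ᵐ x ∂μ, Tendsto (fun i => w i x) l (𝓝 (w₀ x)))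
    (φ : 𝓓(Ω, EuclideanSpace ℝ (Fin n₁))) :
    Tendsto (fun i => ∫ x, w i x * partialDiv φ x ∂μ) l (𝓝 (∫ x, w₀ x * partialDiv φ x ∂μ)) := by
  refine tendsto_integral_filter_of_dominated_convergence (fun x => C * ‖partialDiv φ x‖) ?_ ?_ ?_ ?_
  · filter_upwards [hmeas] with i hi
    exact hi.mul φ.continuous_partialDiv.aestronglyMeasurable
  · filter_upwards [hb] with i hi
    refine Eventually.of_forall fun x => ?_
    rw [norm_mul]
    gcongr
    exact hi x
  · exact (φ.integrable_partialDiv.mono_measure hμ).norm.const_mul C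
  · filter_upwards [hlim] with x hx
    exact hx.mul_const _

theorem dualVariation_le_liminf {w : ℕ → SplitSpace n₁ m → ℝ} {w₀ : SplitSpace n₁ m → ℝ} {C : ℝ}
    (hmeas : ∀ i, AEStronglyMeasurable (w i) (volume.restrict (Ω : Set (SplitSpace n₁ m))))
    (hb : ∀ i x, ‖w i x‖ ≤ C)
    (hlim : ∀ᵐ x ∂(volume.restrict (Ω : Set (SplitSpace n₁ m))),
      Tendsto (fun i => w i x) atTop (𝓝 (w₀ x))) :
    dualVariation Ω w₀ ≤ liminf (fun i => dualVariation Ω (w i)) atTop := by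
  refine iSup₂_le fun φ hφ => ?_
  have h := ENNReal.tendsto_ofReal (tendsto_integral_mul_partialDiv Measure.restrict_le_self
    (Eventually.of_forall hmeas) (Eventually.of_forall hb) hlim φ)
  rw [← h.liminf_eq]
  exact liminf_le_liminf (Eventually.of_forall fun i => le_dualVariation (w i) φ hφ)

/-- The variation of a family that is pointwise continuous from the right in a real parameter is a
measurable function of the parameter. -/
theorem measurable_dualVariation {w : ℝ → SplitSpace n₁ m → ℝ} {C : ℝ}
    (hmeas : ∀ t, AEStronglyMeasurable (w t) (volume.restrict (Ω : Set (SplitSpace n₁ m))))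
    (hb : ∀ t x, ‖w t x‖ ≤ C)
    (hw : ∀ t x, Tendsto (fun s => w s x) (𝓝[>] t) (𝓝 (w t x))) :
    Measurable fun t => dualVariation Ω (w t) := by
  -- The supremum is over an uncountable family, but a set of reals that contains a right
  -- neighbourhood of each of its points is measurable. If the variation at `t` exceeds `a`, a
  -- single field witnesses this and still does so for parameters slightly above `t`.
  refine measurable_of_Ioi fun a => MeasurableSet.of_mem_nhdsGT fun t ht => ?_
  obtain ⟨φ, h⟩ := lt_iSup_iff.1 (show a < dualVariation Ω (w t) from ht)
  obtain ⟨hφ, h⟩ := lt_iSup_iff.1 h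
  have hlim := ENNReal.tendsto_ofReal (tendsto_integral_mul_partialDiv Measure.restrict_le_self
    (Eventually.of_forall hmeas) (Eventually.of_forall hb) (Eventually.of_forall (hw t)) φ)
  filter_upwards [hlim.eventually_const_lt h] with s hs
  exact lt_of_lt_of_le hs (le_dualVariation (w s) φ hφ)

end Semicontinuity

section IntegrationByParts

variable {n₁ m : ℕ} {Ω : Opens (SplitSpace n₁ m)}

theorem integral_mul_partialDiv_eq_neg {f : SplitSpace n₁ m → ℝ} (hf : ContDiff ℝ 1 f)
    (φ : 𝓓(Ω, EuclideanSpace ℝ (Fin n₁))) :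
    ∫ x, f x * partialDiv φ x
      = -∫ x, ∑ i, fderiv ℝ f x (EuclideanSpace.single i 1, 0) * φ x i := by
  have hφ := φ.contDiff_one
  have hcf : ∀ v, Continuous fun x => fderiv ℝ f x v := fun v =>
    (hf.continuous_fderiv one_ne_zero).clm_apply continuous_const
  have hcoord : ∀ i, ContDiff ℝ 1 fun x => φ x i := fun i =>
    (EuclideanSpace.proj (𝕜 := ℝ) i).contDiff.comp hφ
  have hsupp : ∀ i, HasCompactSupport fun x => φ x i := fun i =>
    φ.hasCompactSupport.comp_left (g := fun y : EuclideanSpace ℝ (Fin n₁) => y i) rfl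
  have hfd : ∀ i x v, (fderiv ℝ φ x v) i = fderiv ℝ (fun x => φ x i) x v := by
    intro i x v
    have h := ((EuclideanSpace.proj (𝕜 := ℝ) i).hasFDerivAt.comp x
      (φ.differentiable x).hasFDerivAt).fderiv
    exact (congrArg (fun L => L v) h).symm
  have hcd : ∀ i v, Continuous fun x => fderiv ℝ (fun x => φ x i) x v := fun i v =>
    ((hcoord i).continuous_fderiv one_ne_zero).clm_apply continuous_const
  have hint1 : ∀ i v, Integrable fun x => fderiv ℝ f x v * φ x i := fun i v =>
    ((hcf v).mul (hcoord i).continuous).integrable_of_hasCompactSupport (hsupp i).mul_left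
  have hint2 : ∀ i v, Integrable fun x => f x * fderiv ℝ (fun x => φ x i) x v := fun i v =>
    (hf.continuous.mul (hcd i v)).integrable_of_hasCompactSupport
      ((hsupp i).fderiv_apply ℝ v).mul_left
  simp_rw [partialDiv, hfd, Finset.mul_sum]
  rw [integral_finsetSum _ fun i _ => hint2 i _, integral_finsetSum _ fun i _ => hint1 i _,
    ← Finset.sum_neg_distrib]
  refine Finset.sum_congr rfl fun i _ => ?_
  exact integral_mul_fderiv_eq_neg_fderiv_mul_of_integrable (hint1 i _) (hint2 i _)
    ((hf.continuous.mul (hcoord i).continuous).integrable_of_hasCompactSupport (hsupp i).mul_left)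
    (fun x _ => hf.differentiable one_ne_zero x)
    (fun x _ => (hcoord i).differentiable one_ne_zero x)

theorem integral_partialDiv (φ : 𝓓(Ω, EuclideanSpace ℝ (Fin n₁))) : ∫ x, partialDiv φ x = 0 := by
  have h := integral_mul_partialDiv_eq_neg (f := fun _ => (1 : ℝ)) contDiff_const φ
  simpa using h

/-- The product of a test field with a smooth function. -/
noncomputable def TestFunction.smulSmooth {a : SplitSpace n₁ m → ℝ} (ha : ContDiff ℝ ∞ a)
    (φ : 𝓓(Ω, EuclideanSpace ℝ (Fin n₁))) : 𝓓(Ω, EuclideanSpace ℝ (Fin n₁)) :=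
  have h : ContDiff ℝ ∞ (φ : SplitSpace n₁ m → EuclideanSpace ℝ (Fin n₁)) := φ.contDiff
  ⟨a • (φ : SplitSpace n₁ m → EuclideanSpace ℝ (Fin n₁)), ha.smul h,
    φ.hasCompactSupport.smul_left,
    (tsupport_smul_subset_right a φ).trans φ.tsupport_subset⟩

theorem TestFunction.smulSmooth_apply {a : SplitSpace n₁ m → ℝ} (ha : ContDiff ℝ ∞ a)
    (φ : 𝓓(Ω, EuclideanSpace ℝ (Fin n₁))) (x : SplitSpace n₁ m) :
    φ.smulSmooth ha x = a x • φ x :=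
  rfl

/-- Composition with smooth functions of one variable, tested against different fields, is tested by
a single field. -/
theorem sum_integral_comp_mul_partialDiv {ι : Type*} (S : Finset ι) {G : ι → ℝ → ℝ}
    (hG : ∀ j, ContDiff ℝ ∞ (G j)) (hG' : ∀ s, ∑ j ∈ S, |deriv (G j) s| ≤ 1)
    (φ : ι → 𝓓(Ω, EuclideanSpace ℝ (Fin n₁))) (hφ : ∀ j x, ‖φ j x‖ ≤ 1)
    {w : SplitSpace n₁ m → ℝ} (hw : ContDiff ℝ ∞ w) :
    ∃ ψ : 𝓓(Ω, EuclideanSpace ℝ (Fin n₁)), (∀ x, ‖ψ x‖ ≤ 1) ∧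
      (∀ x, ψ x ≠ 0 → ∃ j ∈ S, x ∈ tsupport (φ j)) ∧
      ∑ j ∈ S, ∫ x, G j (w x) * partialDiv (φ j) x = ∫ x, w x * partialDiv ψ x := by
  have hd : ∀ j, ContDiff ℝ ∞ fun x => deriv (G j) (w x) := fun j =>
    ((contDiff_infty_iff_deriv.1 (hG j)).2).comp hw
  have hw1 : ContDiff ℝ 1 w := hw.of_le (by exact_mod_cast le_top)
  -- By the chain rule, ∇(G_j ∘ w) · φ_j = ∇w · (G_j'(w) φ_j). Summation over `j` followed by
  -- integration by parts on both sides leaves this one field, whose norm is at most ∑ |G_j'(w)| ≤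
  -- 1.
  let ψ : 𝓓(Ω, EuclideanSpace ℝ (Fin n₁)) := ∑ j ∈ S, (φ j).smulSmooth (hd j)
  have hψ : ∀ x, ψ x = ∑ j ∈ S, deriv (G j) (w x) • φ j x := by
    intro x
    simp only [ψ, FunLike.coe_sum, Finset.sum_apply, TestFunction.smulSmooth_apply]
  refine ⟨ψ, fun x => ?_, fun x hx => ?_, ?_⟩
  · rw [hψ]
    refine (norm_sum_le _ _).trans ((Finset.sum_le_sum fun j _ => ?_).trans (hG' (w x)))
    rw [norm_smul, Real.norm_eq_abs]
    exact mul_le_of_le_one_right (abs_nonneg _) (hφ j x)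
  · by_contra! h
    refine hx ?_
    rw [hψ]
    refine Finset.sum_eq_zero fun j hj => ?_
    rw [image_eq_zero_of_notMem_tsupport (h j hj), smul_zero]
  · have hGw : ∀ j, ContDiff ℝ 1 fun x => G j (w x) := fun j =>
      ((hG j).comp hw).of_le (by exact_mod_cast le_top)
    have hfd : ∀ j x v, fderiv ℝ (fun x => G j (w x)) x v = deriv (G j) (w x) * fderiv ℝ w x v := by
      intro j x v
      have h := ((hG j).differentiable (by simp) (w x)).hasDerivAt.comp_hasFDerivAt x
        (hw.differentiable (by simp) x).hasFDerivAt
      exact congrArg (fun L => L v) h.fderiv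
    rw [integral_mul_partialDiv_eq_neg hw1, Finset.sum_congr rfl fun j _ =>
      integral_mul_partialDiv_eq_neg (hGw j) (φ j), Finset.sum_neg_distrib, ← integral_finsetSum]
    · congr 2
      ext x
      rw [Finset.sum_comm]
      refine Finset.sum_congr rfl fun i _ => ?_
      simp only [hψ, hfd, WithLp.ofLp_sum, Finset.sum_apply, Finset.mul_sum, PiLp.smul_apply,
        smul_eq_mul]
      refine Finset.sum_congr rfl fun j _ => ?_
      ring
    · intro j _
      refine integrable_finsetSum _ fun i _ => ?_
      refine Continuous.integrable_of_hasCompactSupport ?_ ?_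
      · exact (((hGw j).continuous_fderiv one_ne_zero).clm_apply continuous_const).mul
          ((EuclideanSpace.proj (𝕜 := ℝ) i).continuous.comp (φ j).continuous)
      · exact ((φ j).hasCompactSupport.comp_left
          (g := fun y : EuclideanSpace ℝ (Fin n₁) => y i) rfl).mul_left

end IntegrationByParts

end

/-! ### Mollification and the variation of compositions -/

section

open Filter Topology
open scoped NNReal ContDiff

section Mollification

instance isNegInvariant_volume_splitSpace (n₁ m : ℕ) :
    Measure.IsNegInvariant (volume : Measure (SplitSpace n₁ m)) :=
  Measure.IsAddHaarMeasure.isNegInvariant_of_regular _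

variable {n₁ m : ℕ} {Ω : Opens (SplitSpace n₁ m)} {u : SplitSpace n₁ m → ℝ}

/-- Translation of a test field by a vector that keeps its support in `Ω`. -/
noncomputable def TestFunction.translate (ψ : 𝓓(Ω, EuclideanSpace ℝ (Fin n₁)))
    (y : SplitSpace n₁ m) (hy : ∀ x ∈ tsupport ψ, x - y ∈ Ω) :
    𝓓(Ω, EuclideanSpace ℝ (Fin n₁)) :=
  have h : ContDiff ℝ ∞ (ψ : SplitSpace n₁ m → EuclideanSpace ℝ (Fin n₁)) := ψ.contDiff
  ⟨fun x => ψ (x + y), h.comp (contDiff_id.add contDiff_const),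
    ψ.hasCompactSupport.comp_homeomorph (Homeomorph.addRight y), by
      intro x hx
      have h1 : x + y ∈ tsupport ψ :=
        tsupport_comp_subset_preimage ψ (continuous_id.add continuous_const) hx
      simpa using hy _ h1⟩

theorem TestFunction.partialDiv_translate (ψ : 𝓓(Ω, EuclideanSpace ℝ (Fin n₁)))
    (y : SplitSpace n₁ m) (hy : ∀ x ∈ tsupport ψ, x - y ∈ Ω) (x : SplitSpace n₁ m) :
    partialDiv (ψ.translate y hy) x = partialDiv ψ (x + y) := by
  have h : fderiv ℝ (ψ.translate y hy) x = fderiv ℝ ψ (x + y) := fderiv_comp_add_right y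
  simp only [partialDiv, h]

theorem integral_indicator_mul_partialDiv (φ : 𝓓(Ω, EuclideanSpace ℝ (Fin n₁))) :
    ∫ x, (Ω : Set (SplitSpace n₁ m)).indicator u x * partialDiv φ x
      = ∫ x in (Ω : Set (SplitSpace n₁ m)), u x * partialDiv φ x := by
  rw [← setIntegral_mul_partialDiv]
  refine setIntegral_congr_fun Ω.isOpen.measurableSet fun x hx => ?_
  simp only [Set.indicator_of_mem hx]

theorem integral_mul_partialDiv_le_toReal (hV : dualVariation Ω u ≠ ⊤)
    (φ : 𝓓(Ω, EuclideanSpace ℝ (Fin n₁))) (hφ : ∀ x, ‖φ x‖ ≤ 1) :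
    ∫ x in (Ω : Set (SplitSpace n₁ m)), u x * partialDiv φ x ≤ (dualVariation Ω u).toReal :=
  (ENNReal.ofReal_le_iff_le_toReal hV).1 (le_dualVariation u φ hφ)

/-- Testing a mollification of `u` against a field whose support stays in `Ω` under the translations
involved. -/
theorem integral_convolution_mul_partialDiv_le (hu : IntegrableOn u Ω)
    (hV : dualVariation Ω u ≠ ⊤) {η : SplitSpace n₁ m → ℝ} (hη0 : ∀ y, 0 ≤ η y)
    (hη : Integrable η) (hη1 : ∫ y, η y = 1) (ψ : 𝓓(Ω, EuclideanSpace ℝ (Fin n₁)))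
    (hψ : ∀ x, ‖ψ x‖ ≤ 1) (hsub : ∀ y, η y ≠ 0 → ∀ x ∈ tsupport ψ, x - y ∈ Ω) :
    ∫ x, convolution η ((Ω : Set (SplitSpace n₁ m)).indicator u)
        (ContinuousLinearMap.lsmul ℝ ℝ) volume x * partialDiv ψ x
      ≤ (dualVariation Ω u).toReal := by
  set v := (Ω : Set (SplitSpace n₁ m)).indicator u with hv
  have hvi : Integrable v := (integrable_indicator_iff Ω.isOpen.measurableSet).2 hu
  obtain ⟨C, hC⟩ := ψ.exists_bound_partialDiv
  have hint : Integrable (fun p : SplitSpace n₁ m × SplitSpace n₁ m =>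
      η p.2 * v (p.1 - p.2) * partialDiv ψ p.1) (volume.prod volume) :=
    (hη.convolution_integrand (ContinuousLinearMap.lsmul ℝ ℝ) hvi).mul_bdd
      (ψ.continuous_partialDiv.comp continuous_fst).aestronglyMeasurable
      (Eventually.of_forall fun p => hC p.1)
  have h1 : ∀ x, convolution η v (ContinuousLinearMap.lsmul ℝ ℝ) volume x * partialDiv ψ x
      = ∫ y, η y * v (x - y) * partialDiv ψ x := by
    intro x
    rw [integral_mul_const]
    rfl
  have h2 : ∀ y, ∫ x, η y * v (x - y) * partialDiv ψ x
      = η y * ∫ x, v x * partialDiv ψ (x + y) := by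
    intro y
    rw [← integral_const_mul,
      ← integral_sub_right_eq_self (fun x => η y * (v x * partialDiv ψ (x + y))) y]
    simp only [sub_add_cancel, mul_assoc]
  -- The translation has been moved from `v` onto the field. For `y` in the support of `η` the
  -- translated field is still an admissible test field on `Ω`, so each slice is at most the
  -- variation of `u`, and `η` has mass one.
  have h3 : ∀ y, η y * ∫ x, v x * partialDiv ψ (x + y) ≤ η y * (dualVariation Ω u).toReal := by
    intro y
    by_cases hy : η y = 0
    · simp [hy]
    · refine mul_le_mul_of_nonneg_left ?_ (hη0 y)
      simp_rw [← TestFunction.partialDiv_translate ψ y (hsub y hy)]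
      rw [hv, integral_indicator_mul_partialDiv]
      exact integral_mul_partialDiv_le_toReal hV _ fun x => hψ (x + y)
  have h4 : Integrable fun y => η y * ∫ x, v x * partialDiv ψ (x + y) := by
    simp_rw [← h2]
    exact hint.integral_prod_right
  simp_rw [h1]
  rw [integral_integral_swap hint]
  simp_rw [h2]
  refine (integral_mono h4 (hη.mul_const _) h3).trans_eq ?_
  rw [integral_mul_const, hη1, one_mul]

/-- A sequence of bump functions at the origin with radii tending to zero. -/
noncomputable def shrinkingBump (n₁ m k : ℕ) : ContDiffBump (0 : SplitSpace n₁ m) :=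
  ⟨1 / (k + 1) / 2, 1 / (k + 1), by positivity, half_lt_self (by positivity)⟩

/-- The chain rule is applied to mollifications of `u` extended by zero. They converge almost
everywhere, and boundedness of the `G j` allows dominated convergence. -/
theorem sum_integral_comp_le (hu : IntegrableOn u Ω) (hV : dualVariation Ω u ≠ ⊤)
    {ι : Type*} (S : Finset ι) {G : ι → ℝ → ℝ} {C : ℝ}
    (hG : ∀ j, ContDiff ℝ ∞ (G j)) (hGb : ∀ j s, ‖G j s‖ ≤ C)
    (hG' : ∀ s, ∑ j ∈ S, |deriv (G j) s| ≤ 1)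
    (φ : ι → 𝓓(Ω, EuclideanSpace ℝ (Fin n₁))) (hφ : ∀ j x, ‖φ j x‖ ≤ 1) :
    ∑ j ∈ S, ∫ x in (Ω : Set (SplitSpace n₁ m)), G j (u x) * partialDiv (φ j) x
      ≤ (dualVariation Ω u).toReal := by
  set v := (Ω : Set (SplitSpace n₁ m)).indicator u with hv
  have hvi : Integrable v := (integrable_indicator_iff Ω.isOpen.measurableSet).2 hu
  let b := shrinkingBump n₁ m
  have hb0 : Tendsto (fun k => (b k).rOut) atTop (𝓝 0) := tendsto_one_div_add_atTop_nhds_zero_nat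
  -- A bounded ratio of the radii is what almost-everywhere convergence of the mollifications
  -- requires.
  have hb2 : ∀ k, (b k).rOut ≤ 2 * (b k).rIn := fun k => by
    simp only [b, shrinkingBump]
    linarith
  let w : ℕ → SplitSpace n₁ m → ℝ := fun k =>
    convolution ((b k).normed volume) v (ContinuousLinearMap.lsmul ℝ ℝ) volume
  have hw : ∀ k, ContDiff ℝ ∞ (w k) := fun k =>
    (b k).hasCompactSupport_normed.contDiff_convolution_left _ (b k).contDiff_normed
      hvi.locallyIntegrable
  have hlim : ∀ᵐ x, Tendsto (fun k => w k x) atTop (𝓝 (v x)) :=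
    ContDiffBump.ae_convolution_tendsto_right_of_locallyIntegrable hb0
      (Eventually.of_forall hb2) hvi.locallyIntegrable
  have hlimS : Tendsto (fun k => ∑ j ∈ S, ∫ x, G j (w k x) * partialDiv (φ j) x) atTop
      (𝓝 (∑ j ∈ S, ∫ x, G j (v x) * partialDiv (φ j) x)) := by
    refine tendsto_finsetSum _ fun j _ => tendsto_integral_mul_partialDiv le_rfl
      (Eventually.of_forall fun k => ?_) (Eventually.of_forall fun k x => hGb j _) ?_ (φ j)
    · exact ((hG j).continuous.comp (hw k).continuous).aestronglyMeasurable
    · filter_upwards [hlim] with x hx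
      exact ((hG j).continuous.tendsto _).comp hx
  have hvu : ∀ j, ∫ x, G j (v x) * partialDiv (φ j) x
      = ∫ x in (Ω : Set (SplitSpace n₁ m)), G j (u x) * partialDiv (φ j) x := by
    intro j
    rw [← setIntegral_mul_partialDiv]
    refine setIntegral_congr_fun Ω.isOpen.measurableSet fun x hx => ?_
    simp only [hv, Set.indicator_of_mem hx]
  simp_rw [hvu] at hlimS
  -- The combined field depends on `k`, but its support stays in this fixed compact set. One margin
  -- `δ` therefore serves all small radii, and any jump of the extension across the boundary of `Ω`
  -- is not seen.
  have hK : IsCompact (⋃ j ∈ S, tsupport (φ j)) :=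
    S.isCompact_biUnion fun j _ => (φ j).hasCompactSupport
  obtain ⟨δ, hδ, hδΩ⟩ := hK.exists_thickening_subset_open Ω.isOpen
    (Set.iUnion₂_subset fun j _ => (φ j).tsupport_subset)
  refine le_of_tendsto hlimS ?_
  filter_upwards [hb0.eventually_lt_const hδ] with k hk
  obtain ⟨ψ, hψ, hψsupp, hsum⟩ := sum_integral_comp_mul_partialDiv S hG hG' φ hφ (hw k)
  rw [hsum]
  refine integral_convolution_mul_partialDiv_le hu hV (fun y => (b k).nonneg_normed y)
    (b k).integrable_normed (b k).integral_normed ψ hψ fun y hy x hx => hδΩ ?_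
  have hxK : x ∈ ⋃ j ∈ S, tsupport (φ j) := by
    refine closure_minimal (fun z hz => ?_) hK.isClosed hx
    obtain ⟨j, hj, hzj⟩ := hψsupp z hz
    exact Set.mem_biUnion hj hzj
  have hy' : y ∈ Metric.ball (0 : SplitSpace n₁ m) (b k).rOut := by
    rw [← (b k).support_normed_eq (μ := volume)]
    exact hy
  refine Metric.mem_thickening_iff.2 ⟨x, hxK, ?_⟩
  rw [dist_eq_norm, sub_sub_cancel_left, norm_neg]
  exact (mem_ball_zero_iff.1 hy').trans hk

/-- The parameters can be chosen independently for each index, so families of choices are directed: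
in each coordinate the better of two choices is kept. -/
theorem sum_iSup_le_of_forall {ι α : Type*} [Nonempty α] (S : Finset ι) (f : ι → α → ℝ≥0∞)
    {C : ℝ≥0∞} (h : ∀ p : ι → α, ∑ j ∈ S, f j (p j) ≤ C) : ∑ j ∈ S, ⨆ a, f j a ≤ C := by
  classical
  have h1 : ∀ j, ⨆ a, f j a = ⨆ p : ι → α, f j (p j) := fun j =>
    (Function.Surjective.iSup_comp (f := fun p : ι → α => p j) (Function.surjective_eval j) (f j)).symm
  simp_rw [h1]
  rw [ENNReal.finsetSum_iSup]
  · exact iSup_le h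
  · intro p q
    refine ⟨fun j => if f j (p j) ≤ f j (q j) then q j else p j, fun j => ?_⟩
    by_cases hj : f j (p j) ≤ f j (q j)
    · simp [hj]
    · simp [hj, (not_le.1 hj).le]

theorem sum_dualVariation_comp_le (hu : IntegrableOn u Ω)
    {ι : Type*} (S : Finset ι) {G : ι → ℝ → ℝ} {C : ℝ}
    (hG : ∀ j, ContDiff ℝ ∞ (G j)) (hGb : ∀ j s, ‖G j s‖ ≤ C)
    (hG' : ∀ s, ∑ j ∈ S, |deriv (G j) s| ≤ 1) :
    ∑ j ∈ S, dualVariation Ω (fun x => G j (u x)) ≤ dualVariation Ω u := by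
  rcases eq_or_ne (dualVariation Ω u) ∞ with hV | hV
  · rw [hV]; exact le_top
  have : Nonempty {φ : 𝓓(Ω, EuclideanSpace ℝ (Fin n₁)) // ∀ x, ‖φ x‖ ≤ 1} :=
    ⟨0, fun x => by simp⟩
  have hsub : ∀ w : SplitSpace n₁ m → ℝ, dualVariation Ω w
      = ⨆ p : {φ : 𝓓(Ω, EuclideanSpace ℝ (Fin n₁)) // ∀ x, ‖φ x‖ ≤ 1},
        ENNReal.ofReal (∫ x in (Ω : Set (SplitSpace n₁ m)), w x * partialDiv p.1 x) := fun w =>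
    iSup_subtype'
  rw [Finset.sum_congr rfl fun j _ => hsub fun x => G j (u x)]
  refine sum_iSup_le_of_forall S _ fun p => ?_
  classical
  -- Fields with negative integral are replaced by zero. This does not change the truncated values,
  -- and it lets `ENNReal.ofReal` commute with the sum.
  let φ : ι → 𝓓(Ω, EuclideanSpace ℝ (Fin n₁)) := fun j =>
    if 0 ≤ ∫ x in (Ω : Set (SplitSpace n₁ m)), G j (u x) * partialDiv (p j).1 x then (p j).1 else 0
  have hφ : ∀ j x, ‖φ j x‖ ≤ 1 := by
    intro j x
    by_cases hj : 0 ≤ ∫ x in (Ω : Set (SplitSpace n₁ m)), G j (u x) * partialDiv (p j).1 x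
    · simp only [φ, hj, if_true]; exact (p j).2 x
    · simp [φ, hj]
  have h0 : ∀ x, partialDiv (0 : 𝓓(Ω, EuclideanSpace ℝ (Fin n₁))) x = 0 := fun x =>
    partialDiv_eq_zero_of_notMem_tsupport (by simp [FunLike.coe_zero])
  have hterm : ∀ j, ENNReal.ofReal
      (∫ x in (Ω : Set (SplitSpace n₁ m)), G j (u x) * partialDiv (p j).1 x)
      = ENNReal.ofReal (∫ x in (Ω : Set (SplitSpace n₁ m)), G j (u x) * partialDiv (φ j) x) ∧
      0 ≤ ∫ x in (Ω : Set (SplitSpace n₁ m)), G j (u x) * partialDiv (φ j) x := by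
    intro j
    by_cases hj : 0 ≤ ∫ x in (Ω : Set (SplitSpace n₁ m)), G j (u x) * partialDiv (p j).1 x
    · simp only [φ, hj, if_true, and_self]
    · simp only [φ, hj, if_false, h0, mul_zero, integral_zero, le_refl, and_true]
      rw [ENNReal.ofReal_zero, ENNReal.ofReal_eq_zero]
      exact (not_le.1 hj).le
  simp_rw [fun j => (hterm j).1]
  rw [← ENNReal.ofReal_sum_of_nonneg fun j _ => (hterm j).2, ENNReal.ofReal_le_iff_le_toReal hV]
  exact sum_integral_comp_le hu hV S hG hGb hG' φ hφ

end Mollification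

end

/-! ### The coarea formula for the dual variation -/

section Coarea

open Filter Topology
open scoped NNReal ContDiff

/-- The average of the smooth transition over `[s - 1, s]`: a smooth function equal to `0` for
`s ≤ 0` and to `1` for `2 ≤ s`. -/
noncomputable def smoothRamp (s : ℝ) : ℝ :=
  ∫ r in (s - 1)..s, Real.smoothTransition r

/-- The reason for averaging: the derivative is a difference of unit translates of one monotone
function, so sums over integer translates of the ramp telescope. -/
theorem hasDerivAt_smoothRamp (s : ℝ) :
    HasDerivAt smoothRamp (Real.smoothTransition s - Real.smoothTransition (s - 1)) s := by
  have hc := Real.smoothTransition.continuous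
  have h : smoothRamp = fun s => (∫ r in (0 : ℝ)..s, Real.smoothTransition r)
      - ∫ r in (0 : ℝ)..(s - 1), Real.smoothTransition r := by
    funext s
    rw [intervalIntegral.integral_interval_sub_left (hc.intervalIntegrable _ _)
      (hc.intervalIntegrable _ _)]
    rfl
  have hd : ∀ s, HasDerivAt (fun s => ∫ r in (0 : ℝ)..s, Real.smoothTransition r)
      (Real.smoothTransition s) s := fun s => (hc.integral_hasStrictDerivAt 0 s).hasDerivAt
  rw [h]
  exact (hd s).sub ((hd (s - 1)).comp_sub_const s 1)

theorem contDiff_smoothRamp : ContDiff ℝ ∞ smoothRamp := by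
  rw [contDiff_infty_iff_deriv]
  refine ⟨fun s => (hasDerivAt_smoothRamp s).differentiableAt, ?_⟩
  have h : deriv smoothRamp
      = fun s => Real.smoothTransition s - Real.smoothTransition (s - 1) :=
    funext fun s => (hasDerivAt_smoothRamp s).deriv
  rw [h]
  exact Real.smoothTransition.contDiff.sub
    (Real.smoothTransition.contDiff.comp (contDiff_id.sub contDiff_const))

theorem norm_smoothRamp_le (s : ℝ) : ‖smoothRamp s‖ ≤ 1 := by
  have h := intervalIntegral.norm_integral_le_of_norm_le_const (a := s - 1) (b := s) (C := 1)
    (f := Real.smoothTransition) fun r _ => by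
      rw [Real.norm_of_nonneg (Real.smoothTransition.nonneg r)]
      exact Real.smoothTransition.le_one r
  rwa [sub_sub_cancel, abs_one, mul_one] at h

theorem smoothRamp_of_nonpos {s : ℝ} (hs : s ≤ 0) : smoothRamp s = 0 := by
  have h : smoothRamp s = ∫ r in (s - 1)..s, (0 : ℝ) := by
    refine intervalIntegral.integral_congr fun r hr => ?_
    rw [Set.uIcc_of_le (by linarith)] at hr
    exact Real.smoothTransition.zero_of_nonpos (hr.2.trans hs)
  rw [h, intervalIntegral.integral_zero]

theorem smoothRamp_of_two_le {s : ℝ} (hs : 2 ≤ s) : smoothRamp s = 1 := by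
  have h : smoothRamp s = ∫ r in (s - 1)..s, (1 : ℝ) := by
    refine intervalIntegral.integral_congr fun r hr => ?_
    rw [Set.uIcc_of_le (by linarith)] at hr
    exact Real.smoothTransition.one_of_one_le (by linarith [hr.1])
  rw [h]
  simp

theorem sum_abs_smoothTransition_sub_le (S : Finset ℤ) (s : ℝ) :
    ∑ j ∈ S, |Real.smoothTransition (s - j) - Real.smoothTransition (s - j - 1)| ≤ 1 := by
  obtain ⟨l, hl⟩ := S.bddBelow
  obtain ⟨b, hb⟩ := S.bddAbove
  -- Since the terms are nonnegative, `S` may be enlarged to an integer interval. Monotonicity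
  -- removes the absolute values, and the sum telescopes to a difference of two values in [0, 1].
  have hsub : S ⊆ (Finset.range (b - l + 1).toNat).image fun k : ℕ => l + (k : ℤ) := by
    intro j hj
    have h1 := hl hj
    have h2 := hb hj
    rw [Finset.mem_image]
    exact ⟨(j - l).toNat, by rw [Finset.mem_range]; omega, by omega⟩
  refine (Finset.sum_le_sum_of_subset_of_nonneg hsub fun _ _ _ => abs_nonneg _).trans ?_
  rw [Finset.sum_image fun _ _ _ _ h => by simpa using h]
  have hterm : ∀ k : ℕ, |Real.smoothTransition (s - ((l + (k : ℤ) : ℤ) : ℝ))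
      - Real.smoothTransition (s - ((l + (k : ℤ) : ℤ) : ℝ) - 1)|
      = Real.smoothTransition (s - (l + (k : ℝ)))
        - Real.smoothTransition (s - (l + ((k + 1 : ℕ) : ℝ))) := by
    intro k
    push_cast
    rw [abs_of_nonneg (sub_nonneg.2 (Real.smoothTransition.monotone (by linarith)))]
    ring_nf
  simp_rw [hterm]
  rw [Finset.sum_range_sub' fun k : ℕ => Real.smoothTransition (s - (l + (k : ℝ)))]
  linarith [Real.smoothTransition.le_one (s - (l + ((0 : ℕ) : ℝ))),
    Real.smoothTransition.nonneg (s - (l + (((b - l + 1).toNat : ℕ) : ℝ)))]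

theorem hasDerivAt_mul_smoothRamp_div {h : ℝ} (hh : h ≠ 0) (t a : ℝ) :
    HasDerivAt (fun a => h * smoothRamp ((a - t) / h))
      (Real.smoothTransition ((a - t) / h) - Real.smoothTransition ((a - t) / h - 1)) a := by
  have h1 : HasDerivAt (fun a : ℝ => (a - t) / h) (1 / h) a :=
    ((hasDerivAt_id a).sub_const t).div_const h
  refine (((hasDerivAt_smoothRamp ((a - t) / h)).comp a h1).const_mul h).congr_deriv ?_
  rw [mul_one_div, mul_div_cancel₀ _ hh]

variable {n₁ m : ℕ} {Ω : Opens (SplitSpace n₁ m)} {u v : SplitSpace n₁ m → ℝ}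

/-- The factor `h` cancels the 1/h from the inner derivative, so the derivatives of the scaled ramps
sum to at most 1 at every point. -/
theorem sum_dualVariation_smoothRamp_le (hu : IntegrableOn u Ω) {h : ℝ} (hh : 0 < h) (t : ℝ)
    (S : Finset ℤ) :
    ∑ j ∈ S, ENNReal.ofReal h * dualVariation Ω (fun x => smoothRamp ((u x - (t + j • h)) / h))
      ≤ dualVariation Ω u := by
  simp_rw [← dualVariation_const_mul hh.le]
  refine sum_dualVariation_comp_le (C := h) hu S
    (G := fun j a => h * smoothRamp ((a - (t + j • h)) / h)) (fun j => ?_) (fun j s => ?_)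
    fun s => ?_
  · exact contDiff_const.mul (contDiff_smoothRamp.comp
      ((contDiff_id.sub contDiff_const).div_const h))
  · rw [norm_mul, Real.norm_of_nonneg hh.le]
    exact mul_le_of_le_one_right hh.le (norm_smoothRamp_le _)
  · have hs : ∀ j : ℤ, (s - (t + j • h)) / h = (s - t) / h - j := by
      intro j
      rw [zsmul_eq_mul]
      field_simp
      ring
    simp_rw [(hasDerivAt_mul_smoothRamp_div hh.ne' _ s).deriv, hs]
    exact sum_abs_smoothTransition_sub_le S _

theorem aestronglyMeasurable_smoothRamp (hu : IntegrableOn u Ω) (h t : ℝ) :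
    AEStronglyMeasurable (fun x => smoothRamp ((u x - t) / h))
      (volume.restrict (Ω : Set (SplitSpace n₁ m))) := by
  have hc : Continuous fun a : ℝ => smoothRamp ((a - t) / h) :=
    contDiff_smoothRamp.continuous.comp (by fun_prop)
  exact hc.comp_aestronglyMeasurable hu.1

theorem measurable_dualVariation_smoothRamp (hu : IntegrableOn u Ω) (h : ℝ) :
    Measurable fun t => dualVariation Ω (fun x => smoothRamp ((u x - t) / h)) := by
  refine measurable_dualVariation (C := 1) (fun t => aestronglyMeasurable_smoothRamp hu h t)
    (fun t x => norm_smoothRamp_le _) fun t x => ?_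
  have hc : Continuous fun t : ℝ => smoothRamp ((u x - t) / h) :=
    contDiff_smoothRamp.continuous.comp (by fun_prop)
  exact (hc.tendsto t).mono_left nhdsWithin_le_nhds

/-- The line is cut into cells of length `h`, all translated to (0, h]. There the sum over the cells
is at most V(u)/h at every offset, and the cell length cancels the `h`. -/
theorem lintegral_dualVariation_smoothRamp_le (hu : IntegrableOn u Ω) {h : ℝ} (hh : 0 < h) :
    ∫⁻ t, dualVariation Ω (fun x => smoothRamp ((u x - t) / h)) ≤ dualVariation Ω u := by
  set F : ℝ → ℝ≥0∞ := fun t => dualVariation Ω (fun x => smoothRamp ((u x - t) / h)) with hF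
  have hFm : Measurable F := measurable_dualVariation_smoothRamp hu h
  have hh0 : ENNReal.ofReal h ≠ 0 := by simpa using hh
  have hsplit : ∫⁻ t, F t = ∑' n : ℤ, ∫⁻ t in Set.Ioc (n • h) ((n + 1) • h), F t := by
    rw [← lintegral_iUnion (fun _ => measurableSet_Ioc) (Set.pairwise_disjoint_Ioc_zsmul h),
      iUnion_Ioc_zsmul hh, setLIntegral_univ]
  have hshift : ∀ n : ℤ, ∫⁻ t in Set.Ioc (n • h) ((n + 1) • h), F t
      = ∫⁻ t in Set.Ioc 0 h, F (t + n • h) := by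
    intro n
    rw [← (measurePreserving_add_right volume (n • h)).setLIntegral_comp_preimage
      measurableSet_Ioc hFm, Set.preimage_add_const_Ioc, sub_self, add_smul, one_smul,
      add_sub_cancel_left]
  have hpoint : ∀ t, ∑' n : ℤ, F (t + n • h) ≤ (ENNReal.ofReal h)⁻¹ * dualVariation Ω u := by
    intro t
    refine ENNReal.summable.tsum_le_of_sum_le fun S => ?_
    rw [← ENNReal.mul_le_iff_le_inv hh0 ENNReal.ofReal_ne_top, Finset.mul_sum]
    exact sum_dualVariation_smoothRamp_le hu hh t S
  rw [hsplit]
  simp_rw [hshift]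
  rw [← lintegral_tsum fun n : ℤ => show AEMeasurable (fun t => F (t + n • h)) _ from
    (hFm.comp (measurable_add_const _)).aemeasurable]
  refine (lintegral_mono hpoint).trans ?_
  rw [setLIntegral_const, Real.volume_Ioc, sub_zero, mul_right_comm,
    ENNReal.inv_mul_cancel hh0 ENNReal.ofReal_ne_top, one_mul]

theorem superlevelIndicator_of_mem {t : ℝ} {x : SplitSpace n₁ m} (hx : x ∈ Ω) :
    superlevelIndicator Ω u t x = (Set.Ioi t).indicator (fun _ => (1 : ℝ)) (u x) := by
  by_cases h : t < u x
  · rw [Set.indicator_of_mem (Set.mem_Ioi.2 h)]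
    exact Set.indicator_of_mem (show x ∈ superlevelSet Ω u t from ⟨hx, h⟩) _
  · rw [Set.indicator_of_notMem (s := Set.Ioi t) fun h' => h h']
    exact Set.indicator_of_notMem (fun h' : x ∈ superlevelSet Ω u t => h h'.2) _

theorem norm_superlevelIndicator_le (t : ℝ) (x : SplitSpace n₁ m) :
    ‖superlevelIndicator Ω u t x‖ ≤ 1 := by
  refine (norm_indicator_le_norm_self _ _).trans ?_
  simp

theorem superlevelIndicator_ae_eq (t : ℝ) :
    superlevelIndicator Ω u t =ᵐ[volume.restrict (Ω : Set (SplitSpace n₁ m))]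
      fun x => (Set.Ioi t).indicator (fun _ => (1 : ℝ)) (u x) :=
  (ae_restrict_mem Ω.isOpen.measurableSet).mono fun _ hx => superlevelIndicator_of_mem hx

theorem aestronglyMeasurable_superlevelIndicator (hu : IntegrableOn u Ω) (t : ℝ) :
    AEStronglyMeasurable (superlevelIndicator Ω u t)
      (volume.restrict (Ω : Set (SplitSpace n₁ m))) := by
  refine AEStronglyMeasurable.congr ?_ (superlevelIndicator_ae_eq t).symm
  exact ((measurable_const.indicator measurableSet_Ioi).comp_aemeasurable
    hu.1.aemeasurable).aestronglyMeasurable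

/-- The strict inequality in the definition of E_t makes t ↦ χ_{E_t}(x) continuous from the right at
each point. -/
theorem measurable_dualVariation_superlevelIndicator (hu : IntegrableOn u Ω) :
    Measurable fun t => dualVariation Ω (superlevelIndicator Ω u t) := by
  refine measurable_dualVariation (C := 1) (aestronglyMeasurable_superlevelIndicator hu)
    norm_superlevelIndicator_le fun t x => ?_
  refine tendsto_const_nhds.congr' ?_
  by_cases h : t < u x
  · filter_upwards [Ioo_mem_nhdsGT h] with s hs
    exact Set.indicator_eq_indicator (and_congr_right fun _ => iff_of_true h hs.2) rfl
  · filter_upwards [self_mem_nhdsWithin] with s hs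
    exact Set.indicator_eq_indicator
      (and_congr_right fun _ => iff_of_false h fun h' => h (lt_trans hs h')) rfl

/-- The ramp vanishes up to and including 0, so the limit is right also where u(x) = t. -/
theorem tendsto_smoothRamp_superlevelIndicator (t : ℝ) {x : SplitSpace n₁ m} (hx : x ∈ Ω) :
    Tendsto (fun k : ℕ => smoothRamp ((u x - t) / (1 / ((k : ℝ) + 1)))) atTop
      (𝓝 (superlevelIndicator Ω u t x)) := by
  rw [superlevelIndicator_of_mem hx]
  refine tendsto_const_nhds.congr' ?_
  by_cases h : t < u x
  · rw [Set.indicator_of_mem (Set.mem_Ioi.2 h)]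
    have hlim : Tendsto (fun k : ℕ => (u x - t) * ((k : ℝ) + 1)) atTop atTop :=
      (tendsto_natCast_atTop_atTop.atTop_add tendsto_const_nhds).const_mul_atTop (sub_pos.2 h)
    filter_upwards [hlim.eventually_ge_atTop 2] with k hk
    rw [div_div_eq_mul_div, div_one, smoothRamp_of_two_le hk]
  · rw [Set.indicator_of_notMem (s := Set.Ioi t) fun h' => h h']
    refine Eventually.of_forall fun k => (smoothRamp_of_nonpos ?_).symm
    exact div_nonpos_of_nonpos_of_nonneg (by linarith) (by positivity)

theorem lintegral_dualVariation_superlevelIndicator_le (hu : IntegrableOn u Ω) :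
    ∫⁻ t, dualVariation Ω (superlevelIndicator Ω u t) ≤ dualVariation Ω u := by
  let F : ℕ → ℝ → ℝ≥0∞ := fun k t =>
    dualVariation Ω (fun x => smoothRamp ((u x - t) / (1 / ((k : ℝ) + 1))))
  calc ∫⁻ t, dualVariation Ω (superlevelIndicator Ω u t)
      ≤ ∫⁻ t, liminf (fun k => F k t) atTop := by
        refine lintegral_mono fun t => dualVariation_le_liminf (C := 1)
          (fun k => aestronglyMeasurable_smoothRamp hu _ t) (fun k x => norm_smoothRamp_le _) ?_
        filter_upwards [ae_restrict_mem Ω.isOpen.measurableSet] with x hx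
        exact tendsto_smoothRamp_superlevelIndicator t hx
    _ ≤ liminf (fun k => ∫⁻ t, F k t) atTop :=
        lintegral_liminf_le fun k => measurable_dualVariation_smoothRamp hu _
    _ ≤ dualVariation Ω u :=
        liminf_le_of_le (by isBoundedDefault) fun b hb => by
          obtain ⟨k, hk⟩ := hb.exists
          exact hk.trans (lintegral_dualVariation_smoothRamp_le hu (by positivity))

/-- The jump of the indicator of the superlevel set, normalized to vanish at the value `0`. -/
noncomputable def layer (t a : ℝ) : ℝ :=
  (Set.Ioi t).indicator (fun _ => (1 : ℝ)) a - (Set.Ioi t).indicator (fun _ => (1 : ℝ)) 0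

theorem layer_of_nonneg {a : ℝ} (ha : 0 ≤ a) (t : ℝ) :
    layer t a = (Set.Ico 0 a).indicator (fun _ => (1 : ℝ)) t := by
  simp only [layer, Set.indicator, Set.mem_Ioi, Set.mem_Ico]
  split_ifs <;> grind

theorem layer_of_nonpos {a : ℝ} (ha : a ≤ 0) (t : ℝ) :
    layer t a = -(Set.Ico a 0).indicator (fun _ => (1 : ℝ)) t := by
  simp only [layer, Set.indicator, Set.mem_Ioi, Set.mem_Ico]
  split_ifs <;> grind

theorem integrable_indicator_Ico_one (a b : ℝ) :
    Integrable ((Set.Ico a b).indicator fun _ => (1 : ℝ)) :=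
  (integrable_indicator_iff measurableSet_Ico).2 (integrableOn_const (by simp))

theorem integral_indicator_Ico_one {a b : ℝ} (h : a ≤ b) :
    ∫ t, (Set.Ico a b).indicator (fun _ => (1 : ℝ)) t = b - a := by
  rw [integral_indicator measurableSet_Ico]
  simp [h]

/-- Without the subtracted value at 0, the indicator would equal 1 for all `t` below `a` and not be
integrable. -/
theorem integrable_layer (a : ℝ) : Integrable fun t => layer t a := by
  rcases le_total 0 a with ha | ha
  · simp_rw [layer_of_nonneg ha]
    exact integrable_indicator_Ico_one 0 a
  · simp_rw [layer_of_nonpos ha]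
    exact (integrable_indicator_Ico_one a 0).neg

theorem integral_layer (a : ℝ) : ∫ t, layer t a = a := by
  rcases le_total 0 a with ha | ha
  · simp_rw [layer_of_nonneg ha]
    rw [integral_indicator_Ico_one ha, sub_zero]
  · simp_rw [layer_of_nonpos ha]
    rw [integral_neg, integral_indicator_Ico_one ha, zero_sub, neg_neg]

theorem integral_norm_layer (a : ℝ) : ∫ t, ‖layer t a‖ = |a| := by
  have hn : ∀ c d t : ℝ, ‖(Set.Ico c d).indicator (fun _ => (1 : ℝ)) t‖
      = (Set.Ico c d).indicator (fun _ => (1 : ℝ)) t := fun c d t =>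
    Real.norm_of_nonneg (Set.indicator_nonneg (fun _ _ => zero_le_one) _)
  rcases le_total 0 a with ha | ha
  · simp_rw [layer_of_nonneg ha, hn]
    rw [integral_indicator_Ico_one ha, sub_zero, abs_of_nonneg ha]
  · simp_rw [layer_of_nonpos ha, norm_neg, hn]
    rw [integral_indicator_Ico_one ha, zero_sub, abs_of_nonpos ha]

theorem measurable_layer : Measurable fun p : ℝ × ℝ => layer p.1 p.2 := by
  have h1 : Measurable fun p : ℝ × ℝ => (Set.Ioi p.1).indicator (fun _ => (1 : ℝ)) p.2 :=
    Measurable.ite (measurableSet_lt measurable_fst measurable_snd) measurable_const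
      measurable_const
  exact h1.sub (h1.comp (measurable_fst.prodMk measurable_const))

theorem ofReal_integral_le_lintegral {α : Type*} [MeasurableSpace α] {μ : Measure α} {f : α → ℝ}
    (hf : Integrable f μ) : ENNReal.ofReal (∫ x, f x ∂μ) ≤ ∫⁻ x, ENNReal.ofReal (f x) ∂μ := by
  have h : ∀ x, ENNReal.ofReal (f x) = ENNReal.ofReal (max (f x) 0) := fun x => by
    rw [ENNReal.ofReal_max, ENNReal.ofReal_zero, max_eq_left zero_le]
  simp_rw [h]
  rw [← ofReal_integral_eq_lintegral_ofReal hf.pos_part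
    (Eventually.of_forall fun x => le_max_right _ _)]
  exact ENNReal.ofReal_le_ofReal (integral_mono hf hf.pos_part fun x => le_max_left _ _)

theorem dualVariation_le_lintegral_superlevelIndicator (hu : IntegrableOn u Ω) :
    dualVariation Ω u ≤ ∫⁻ t, dualVariation Ω (superlevelIndicator Ω u t) := by
  set μ := volume.restrict (Ω : Set (SplitSpace n₁ m)) with hμ
  refine iSup₂_le fun φ hφ => ?_
  -- The layer has L¹ norm |u(x)| in `t`, so product integrability comes down to that of `u *
  -- partialDiv φ`.
  have hint : Integrable (fun p : ℝ × SplitSpace n₁ m => layer p.1 (u p.2) * partialDiv φ p.2)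
      (volume.prod μ) := by
    rw [integrable_prod_iff']
    · refine ⟨Eventually.of_forall fun x => (integrable_layer (u x)).mul_const (partialDiv φ x), ?_⟩
      simp_rw [norm_mul, integral_mul_const, integral_norm_layer]
      have := (integrable_mul_partialDiv hu φ).norm
      simp_rw [norm_mul] at this
      exact this
    · refine AEStronglyMeasurable.mul ?_
        (φ.continuous_partialDiv.comp continuous_snd).aestronglyMeasurable
      exact (measurable_layer.comp_aemeasurable (measurable_fst.aemeasurable.prodMk
        hu.1.aemeasurable.comp_snd)).aestronglyMeasurable
  have hslice : ∀ t, ∫ x, layer t (u x) * partialDiv φ x ∂μ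
      = ∫ x, superlevelIndicator Ω u t x * partialDiv φ x ∂μ := by
    intro t
    -- The normalizing term is constant in `x`, and a divergence integrates to zero.
    have h0 : ∫ x, (Set.Ioi t).indicator (fun _ => (1 : ℝ)) 0 * partialDiv φ x ∂μ = 0 := by
      rw [setIntegral_mul_partialDiv, integral_const_mul, integral_partialDiv, mul_zero]
    have h1 : ∫ x, superlevelIndicator Ω u t x * partialDiv φ x ∂μ
        = ∫ x, (Set.Ioi t).indicator (fun _ => (1 : ℝ)) (u x) * partialDiv φ x ∂μ := by
      refine integral_congr_ae ?_
      filter_upwards [superlevelIndicator_ae_eq (Ω := Ω) (u := u) t] with x hx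
      rw [hx]
    simp_rw [layer, sub_mul]
    rw [integral_sub, h0, sub_zero, h1]
    · refine (φ.integrable_partialDiv.mono_measure Measure.restrict_le_self).bdd_mul (c := 1)
        ((aestronglyMeasurable_superlevelIndicator hu t).congr (superlevelIndicator_ae_eq t)) ?_
      refine Eventually.of_forall fun x => (norm_indicator_le_norm_self _ _).trans ?_
      simp
    · exact (φ.integrable_partialDiv.mono_measure Measure.restrict_le_self).const_mul _
  have hlayer : ∫ x, u x * partialDiv φ x ∂μ
      = ∫ t, ∫ x, superlevelIndicator Ω u t x * partialDiv φ x ∂μ := by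
    simp_rw [← hslice]
    rw [integral_integral_swap hint]
    refine integral_congr_ae (Eventually.of_forall fun x => ?_)
    simp only [integral_mul_const, integral_layer]
  have hI : Integrable fun t => ∫ x, superlevelIndicator Ω u t x * partialDiv φ x ∂μ := by
    simp_rw [← hslice]
    exact hint.integral_prod_left
  rw [hlayer]
  exact (ofReal_integral_le_lintegral hI).trans
    (lintegral_mono fun t => le_dualVariation _ φ hφ)

/-- Finite measure of `Ω` is needed here: for negative `t` the set E_t may be almost all of `Ω`. -/
theorem integrableOn_superlevelIndicator (hΩ : volume (Ω : Set (SplitSpace n₁ m)) ≠ ⊤)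
    (hu : IntegrableOn u Ω) (t : ℝ) : IntegrableOn (superlevelIndicator Ω u t) Ω := by
  have : IsFiniteMeasure (volume.restrict (Ω : Set (SplitSpace n₁ m))) :=
    isFiniteMeasure_restrict.2 hΩ
  exact Integrable.of_bound (aestronglyMeasurable_superlevelIndicator hu t) 1
    (Eventually.of_forall (norm_superlevelIndicator_le t))

end Coarea

theorem mainTheorem11 (n₁ m : ℕ)
    (Ω₁ : Opens (EuclideanSpace ℝ (Fin n₁))) (Ω₂ : Opens (EuclideanSpace ℝ (Fin m)))
    (hΩ₁ : Bornology.IsBounded (Ω₁ : Set (EuclideanSpace ℝ (Fin n₁))))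
    (hΩ₂ : Bornology.IsBounded (Ω₂ : Set (EuclideanSpace ℝ (Fin m))))
    (Ω : Opens (SplitSpace n₁ m)) (hΩ : (Ω : Set (SplitSpace n₁ m)) = (Ω₁ : Set _) ×ˢ (Ω₂ : Set _))
    (u : SplitSpace n₁ m → ℝ) (hu : IntegrableOn u Ω) :
    -- the integrand on the right-hand side of the coarea formula is Lebesgue measurable in `t`
    AEMeasurable (fun t : ℝ => partialVariation Ω (superlevelIndicator Ω u t)) volume ∧
    (MemPartialBV Ω u →
      (∀ᵐ t : ℝ, MemPartialBV Ω (superlevelIndicator Ω u t)) ∧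
      partialVariation Ω u = ∫⁻ t : ℝ, partialVariation Ω (superlevelIndicator Ω u t)) ∧
    ((∫⁻ t : ℝ, partialVariation Ω (superlevelIndicator Ω u t)) < ∞ → MemPartialBV Ω u) := by
  have hfin : volume (Ω : Set (SplitSpace n₁ m)) ≠ ⊤ := by
    rw [hΩ]
    exact (hΩ₁.prod hΩ₂).measure_lt_top.ne
  have hint := integrableOn_superlevelIndicator hfin hu
  have hmeas := measurable_dualVariation_superlevelIndicator hu
  have hcoarea : dualVariation Ω u = ∫⁻ t, dualVariation Ω (superlevelIndicator Ω u t) :=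
    le_antisymm (dualVariation_le_lintegral_superlevelIndicator hu)
      (lintegral_dualVariation_superlevelIndicator_le hu)
  -- In terms of the dual variation, both implications concern the same number V(u), and the
  -- almost-everywhere claim is finiteness of an integrand with finite integral.
  simp_rw [fun t => partialVariation_eq_dualVariation (hint t),
    partialVariation_eq_dualVariation hu, fun t => memPartialBV_iff (hint t), memPartialBV_iff hu,
    ← hcoarea]
  refine ⟨hmeas.aemeasurable, fun h => ⟨?_, trivial⟩, id⟩
  exact ae_lt_top hmeas (hcoarea ▸ h.ne)
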